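/- Let $\mathbb{F}$ be a field. A *persistence module* $V$ is a functor from the totally ordered set $\mathbb{Z}$ to $\mathbb{F}$-vector spaces with every $V_t$ finite-dimensional and $V_t=0$ for $t$ outside a bounded range of indices (that is, a module indexed by a finite interval of integers, extended by zero). A *bar* is an interval $J=[i,j]$ of integers with $i\le j$; its length is $|J|=j-i$, and for $\delta\in\mathbb{Z}$ put $J(\delta)=[i-\delta,j-\delta]$. The *interval module* $k_J$ is $\mathbb{F}$ at the indices in $J$ and $0$ elsewhere, with identity inner morphisms within $J$. The *barcode* $\mathrm{Barc}(V)$ is the multiset of bars $J$ such that $V\cong\bigoplus_J k_J$. The *nestedness* of $V$ is $\Xi(V)=\min\{|a-c|,|b-d|\}$, the minimum running over all bars $[a,b],[c,d]$ of $\mathrm{Barc}(V)$ with $c<a\le b<d$, and $\Xi(V)=\infty$ if there are no such bars. The shift of $V$ is $V(\delta)_t=V_{t+\delta}$. For an integer $\delta\ge 0$, a *$\delta$-interleaving pair* between $V$ and $W$ consists of morphisms $\Phi\colon V\to W(\delta)$ and $\Psi\colon W\to V(\delta)$ such that, for all $t$, $\Psi_{t+\delta}\circ\Phi_t$ and $\Phi_{t+\delta}\circ\Psi_t$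 are the inner morphisms $V_t\to V_{t+2\delta}$ and $W_t\to W_{t+2\delta}$. For bars $J=[i_2,j_2]$ and $K=[i_1,j_1]$ with $i_1\le i_2\le j_1\le j_2$, let $\mathbf{R}_K^J$ be the morphism $k_J\to k_K$ that is the identity at the indices in $J\cap K$; let $\mathbf{I}^+_J$ be $k_J\to 0$ and $\mathbf{I}^-_K$ be $0\to k_K$. A *ladder decomposition* of a morphism is an isomorphism (of morphisms of persistence modules) to a finite direct sum of such elementary morphisms. A *partial matching* $\chi$ between multisets $S$ and $T$ is a multiset of pairs whose first entries form a sub-multiset of $S$ and whose second entries form a sub-multiset of $T$; write $(p,\mu)\in\chi$ if the pair $p$ occurs in $\chi$ with multiplicity exactly $\mu>0$. A partial matching $\chi_\Phi$ between $\mathrm{Barc}(V)$ and $\mathrm{Barc}(W)$ is *induced by* $\Phi\colon V\to W(\delta)$ if there is a ladder decomposition of $\Phi$ such that every pair $(J_1,J_2)$ occurs in $\chi_\Phi$ exactly as often as $\mathbf{R}_{J_2(\delta)}^{J_1}$ occurs in that decomposition; likewise for $\Psi$, with the roles of $V$ and $W$ exchanged. **Statement.** Let $V$ and $W$ be persistence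 modules over $\mathbb{F}$ and let $(\Phi,\Psi)$ be a $\delta$-interleaving pair between them with $\delta<\frac12\min(\Xi(V),\Xi(W))$. Then $\Phi$ induces exactly one partial matching $\chi_\Phi$ between $\mathrm{Barc}(V)$ and $\mathrm{Barc}(W)$, and $\Psi$ induces exactly one partial matching $\chi_\Psi$ between $\mathrm{Barc}(W)$ and $\mathrm{Barc}(V)$. Moreover, for all bars $J_V\in\mathrm{Barc}(V)$ and $J_W\in\mathrm{Barc}(W)$ with $|J_V|\ge 2\delta$ and $|J_W|\ge 2\delta$, and for every $\mu\in\mathbb{N}$, $$((J_V,J_W),\mu)\in\chi_\Phi\iff((J_W,J_V),\mu)\in\chi_\Psi .$$ -/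

import Mathlib

open CategoryTheory

universe u

namespace Ladder

/-! ### Bars -/

/-- A bar: a nonempty closed interval `[i, j]` of integers, `i = J.fst ≤ J.snd = j`.
Its length `|J|` is `J.length = j - i`, and `t ∈ J` means `i ≤ t ≤ j`. -/
abbrev Bar : Type := NonemptyInterval ℤ

namespace Bar

/-- The shifted bar `J(δ) = [i - δ, j - δ]`. -/
def shift (δ : ℤ) (J : Bar) : Bar where
  fst := J.fst - δ
  snd := J.snd - δ
  fst_le_snd := Int.sub_le_sub_right J.fst_le_snd δ

/-- The overlapping relation `K ⪯ J`: `[i₁, j₁] ⪯ [i₂, j₂]` iff `i₁ ≤ i₂ ≤ j₁ ≤ j₂`. -/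
def Overlaps (K J : Bar) : Prop :=
  K.fst ≤ J.fst ∧ J.fst ≤ K.snd ∧ K.snd ≤ J.snd

/-- `J` is strictly nested in `K`: `K.fst < J.fst ≤ J.snd < K.snd`. -/
def StrictlyNested (J K : Bar) : Prop :=
  K.fst < J.fst ∧ J.snd < K.snd

end Bar

section Modules

variable (F : Type u) [Field F]

open Classical in
/-- For propositions `p`, `q`, the spaces `PLift p → F` and `PLift q → F` are `F` if the proposition
is true and `0` otherwise. This is the map between them that is the identity of `F` if both
propositions are true, and `0` otherwise. -/
noncomputable def idOrZero (p q : Prop) : (PLift p → F) →ₗ[F] (PLift q → F) where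
  toFun f _ := if hp : p then f ⟨hp⟩ else 0
  map_add' f g := by funext _; by_cases hp : p <;> simp [hp]
  map_smul' c f := by funext _; by_cases hp : p <;> simp [hp]

theorem idOrZero_self (p : Prop) : idOrZero F p p = LinearMap.id := by
  ext f ⟨hp⟩
  simp [idOrZero, hp]

theorem idOrZero_comp {p q r : Prop} (h : p → r → q) :
    idOrZero F q r ∘ₗ idOrZero F p q = idOrZero F p r := by
  ext f ⟨hr⟩
  by_cases hp : p
  · simp [idOrZero, hp, h hp hr]
  · simp [idOrZero, hp]

/-- The interval module `k_J`: it is `F` at the indices in `J` and `0` elsewhere, and its inner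
morphisms are the identity of `F` whenever possible and `0` otherwise. -/
noncomputable def intervalModule (J : Bar) : ℤ ⥤ ModuleCat.{u} F where
  obj t := ModuleCat.of F (PLift (t ∈ J) → F)
  map {s t} _ := ModuleCat.ofHom (idOrZero F (s ∈ J) (t ∈ J))
  map_id t := by rw [idOrZero_self]; rfl
  map_comp {r s t} f g := by
    rw [← ModuleCat.ofHom_comp, idOrZero_comp]
    rintro ⟨h1, _⟩ ⟨_, h4⟩
    exact ⟨h1.trans (leOfHom f), (leOfHom g).trans h4⟩

/-- For `K ⪯ J`, the morphism `k_J ⟶ k_K` that is the identity of `F` at every index in `J ∩ K`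
(and `0` at all other indices). -/
noncomputable def intervalMap (J K : Bar) (h : K.Overlaps J) :
    intervalModule F J ⟶ intervalModule F K where
  app t := ModuleCat.ofHom (idOrZero F (t ∈ J) (t ∈ K))
  naturality {s t} f := by
    change ModuleCat.ofHom _ ≫ ModuleCat.ofHom _ = ModuleCat.ofHom _ ≫ ModuleCat.ofHom _
    have hst : s ≤ t := leOfHom f
    obtain ⟨h1, h2, h3⟩ := h
    rw [← ModuleCat.ofHom_comp, ← ModuleCat.ofHom_comp, idOrZero_comp, idOrZero_comp]
    · rintro ⟨a1, _⟩ ⟨_, b2⟩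
      exact ⟨h1.trans a1, hst.trans b2⟩
    · rintro ⟨a1, _⟩ ⟨_, b2⟩
      exact ⟨a1.trans hst, b2.trans h3⟩

end Modules

/-! ### Persistence modules -/

variable {F : Type u} [Field F]

/-- A functor `V : ℤ ⥤ Vect_F` is a finitely indexed, pointwise finite-dimensional persistence
module if each `V_t` is finite-dimensional and `V_t = 0` outside a bounded range of indices. -/
structure IsPersistenceModule (V : ℤ ⥤ ModuleCat.{u} F) : Prop where
  finite (t : ℤ) : FiniteDimensional F (V.obj t)
  bounded : ∃ a b : ℤ, ∀ t : ℤ, t ∉ Set.Icc a b → Subsingleton (V.obj t)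

/-- The shift `V(δ)`, with `V(δ)_t = V_{t + δ}` and `v(δ)_{s, t} = v_{s + δ, t + δ}`. -/
noncomputable def shift (δ : ℤ) (V : ℤ ⥤ ModuleCat.{u} F) : ℤ ⥤ ModuleCat.{u} F where
  obj t := V.obj (t + δ)
  map f := V.map (homOfLE (Int.add_le_add_right (leOfHom f) δ))
  map_id t := V.map_id (t + δ)
  map_comp _ _ := by rw [← V.map_comp]; rfl

/-- The direct sum of a family of persistence modules. -/
noncomputable def directSum {ι : Type} (M : ι → (ℤ ⥤ ModuleCat.{u} F)) : ℤ ⥤ ModuleCat.{u} F where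
  obj t := ModuleCat.of F (DirectSum ι fun i => (M i).obj t)
  map f := ModuleCat.ofHom (DirectSum.lmap fun i => ((M i).map f).hom)
  map_id t := by
    rw [← ModuleCat.ofHom_id]
    congr 1
    simp only [CategoryTheory.Functor.map_id, ModuleCat.hom_id]
    exact DirectSum.lmap_id
  map_comp f g := by
    rw [← ModuleCat.ofHom_comp]
    congr 1
    simp only [CategoryTheory.Functor.map_comp, ModuleCat.hom_comp]
    exact DirectSum.lmap_comp _ _

/-- The direct sum of a family of morphisms of persistence modules. -/
noncomputable def directSumMap {ι : Type} {M N : ι → (ℤ ⥤ ModuleCat.{u} F)}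
    (f : ∀ i, M i ⟶ N i) : directSum M ⟶ directSum N where
  app t := ModuleCat.ofHom (DirectSum.lmap fun i => ((f i).app t).hom)
  naturality {s t} g := by
    change ModuleCat.ofHom _ ≫ ModuleCat.ofHom _ = ModuleCat.ofHom _ ≫ ModuleCat.ofHom _
    rw [← ModuleCat.ofHom_comp, ← ModuleCat.ofHom_comp, ← DirectSum.lmap_comp,
      ← DirectSum.lmap_comp]
    congr 2
    funext i
    rw [← ModuleCat.hom_comp, ← ModuleCat.hom_comp, (f i).naturality g]

/-! ### Barcodes and nestedness -/

/-- `B` is the multiset of bars appearing in an interval decomposition of `V`. -/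
def IsBarcode (V : ℤ ⥤ ModuleCat.{u} F) (B : Multiset Bar) : Prop :=
  ∃ (ι : Type) (_ : Fintype ι) (J : ι → Bar),
    Finset.univ.val.map J = B ∧ Nonempty (V ≅ directSum fun i => intervalModule F (J i))

/-- The barcode of `V`: the (unique) multiset of bars in an interval decomposition of `V`. -/
noncomputable def barcode (V : ℤ ⥤ ModuleCat.{u} F) : Multiset Bar :=
  Classical.epsilon (IsBarcode V)

/-- The nestedness `Ξ(V)`: the minimum of `min {|a - c|, |b - d|}` over all pairs of bars
`[a, b]` strictly nested in `[c, d]` in the barcode of `V`, and `∞` if there are none. -/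
noncomputable def nestedness (V : ℤ ⥤ ModuleCat.{u} F) : ℕ∞ :=
  ⨅ (J ∈ barcode V) (K ∈ barcode V) (_ : J.StrictlyNested K),
    ((min (J.fst - K.fst).natAbs (J.snd - K.snd).natAbs : ℕ) : ℕ∞)

/-! ### Interleavings -/

/-- `(Φ, Ψ)` is a `δ`-interleaving: `Ψ_{t+δ} ∘ Φ_t = v_{t, t+2δ}` and
`Φ_{t+δ} ∘ Ψ_t = w_{t, t+2δ}` for all `t`. -/
structure IsInterleaving {V W : ℤ ⥤ ModuleCat.{u} F} (δ : ℕ)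
    (Φ : V ⟶ shift δ W) (Ψ : W ⟶ shift δ V) : Prop where
  left (t : ℤ) : (Ψ.app (t + δ)).hom ∘ₗ (Φ.app t).hom =
    (V.map (homOfLE (by lia : t ≤ t + δ + δ))).hom
  right (t : ℤ) : (Φ.app (t + δ)).hom ∘ₗ (Ψ.app t).hom =
    (W.map (homOfLE (by lia : t ≤ t + δ + δ))).hom

/-! ### Ladder decompositions -/

/-- The elementary ladder persistence modules: `R J K` (for `K ⪯ J`, with `J` on the source side
and `K` on the target side), `I⁺_J` and `I⁻_K`. -/
inductive ElementaryLadder : Type where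
  | R (J K : Bar) (h : K.Overlaps J) : ElementaryLadder
  | Iplus (J : Bar) : ElementaryLadder
  | Iminus (K : Bar) : ElementaryLadder

namespace ElementaryLadder

variable (F) in
/-- The ladder persistence module, i.e. the morphism of persistence modules, named by `E`:
`k_J ⟶ k_K` for `R J K`, `k_J ⟶ 0` for `I⁺_J` and `0 ⟶ k_K` for `I⁻_K`. -/
noncomputable def toArrow : ElementaryLadder → Arrow (ℤ ⥤ ModuleCat.{u} F)
  | R J K h => Arrow.mk (intervalMap F J K h)
  | Iplus J => Arrow.mk (0 : intervalModule F J ⟶ (Functor.const ℤ).obj (ModuleCat.of F PUnit))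
  | Iminus K => Arrow.mk (0 : (Functor.const ℤ).obj (ModuleCat.of F PUnit) ⟶ intervalModule F K)

/-- The pair `(J, K)` if the elementary ladder module is `R J K`, and nothing otherwise. -/
def pair? : ElementaryLadder → Option (Bar × Bar)
  | R J K _ => some (J, K)
  | Iplus _ => none
  | Iminus _ => none

end ElementaryLadder

/-- `L` is the multiset of elementary ladder modules appearing in a ladder decomposition of `Φ`,
that is, `(V, W, Φ)` is isomorphic to the direct sum of the elementary ladder modules in `L`. -/
def IsLadderDecomposition {V W : ℤ ⥤ ModuleCat.{u} F} (Φ : V ⟶ W)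
    (L : Multiset ElementaryLadder) : Prop :=
  ∃ (ι : Type) (_ : Fintype ι) (E : ι → ElementaryLadder),
    Finset.univ.val.map E = L ∧
      Nonempty (Arrow.mk Φ ≅ Arrow.mk (directSumMap fun i => ((E i).toArrow F).hom))

/-! ### Partial matchings -/

/-- A partial matching between multisets `S` and `T`, written as a multiset of pairs: its left
members form a sub-multiset of `S` and its right members a sub-multiset of `T`. -/
@[ext]
structure PartialMatching {α β : Type} (S : Multiset α) (T : Multiset β) where
  /-- The multiset of matched pairs. -/
  pairs : Multiset (α × β)
  fst_le : pairs.map Prod.fst ≤ S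
  snd_le : pairs.map Prod.snd ≤ T

/-- A multiset written as the set of its elements together with their (positive) multiplicities. -/
def withMult {α : Type} [DecidableEq α] (S : Multiset α) : Set (α × ℕ) :=
  {p | 0 < p.2 ∧ S.count p.1 = p.2}

/-- `χ` is a partial matching induced by the ladder decomposition of `Φ : V ⟶ W(δ)`: a pair of bars
`(J₁, J₂)` occurs in `χ` exactly as many times as `R` with source bar `J₁` and target bar `J₂(δ)`
occurs in the ladder decomposition of `Φ`. -/
def IsInducedMatching {V W : ℤ ⥤ ModuleCat.{u} F} (δ : ℕ) (Φ : V ⟶ shift δ W)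
    (χ : PartialMatching (barcode V) (barcode W)) : Prop :=
  ∃ L : Multiset ElementaryLadder, IsLadderDecomposition Φ L ∧
    L.filterMap ElementaryLadder.pair? = χ.pairs.map fun p => (p.1, p.2.shift δ)

end Ladder

/-! Interval decompositions are handled as families of sections forming a basis at every index
(`IsIntervalBasis`), ladder decompositions as two such families matched by the morphism
(`IsLadderBasis`). With d = 2δ, replace W by W(δ) and Ψ by its δ-shift: both composites become inner
morphisms of length d, and strictly nested bars of either barcode differ by more than d at both
ends.

Uniqueness is linear algebra. The subspaces im(V_a → V_t) ∩ ker(V_t → V_u) are spanned, in every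
interval basis, by the vectors whose bars contain a and t but not u. The bars at most J modulo those
smaller than J therefore count the multiplicity of J (`card_supports_le`), and comparing such
filtrations through Φ counts the summands `R J K` (`card_R_le`).

Existence is Gaussian elimination on the matrix of Φ. Adding one basis vector to another is
legitimate only if their bars are comparable in the product order, so strictly nested bars are the
only obstruction. Take the largest target bar k₀ hit by an unreduced column and the smallest source
bar j₀ in its row. If a nested bar blocked this pivot, bar j₀ would have length at least d; since ΨΦ
is an inner morphism, its column then has a nonzero entry at a bar whose ends are at least those of
j₀ minus d (`exists_entry_ne_zero`). This contradicts the choice of k₀ or the nestedness bound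
(`exists_isLadderDecomposition`).

For the symmetry, let y be a target vector of a summand `R J K` of Φ with J and K of length at least
d. As ΨΦ is inner, Ψ y has coefficient 1 on its partner over J, and by nestedness all its other bars
are small enough not to disturb the filtration. Applying Φ recovers the coefficients, so Ψ has at
least as many summands `R K J(d)` (`card_R_le_of_interleaving`). Exchanging V and W gives equality.
-/

namespace Ladder

variable {F : Type u} [Field F]

/-! ### Interval bases -/

/-- Families of vectors supported on `S` which are carried to each other by the inner morphisms of
`V`. For `S` an interval these are the morphisms from the interval module of `S` to `V`. -/
def sectionsOn (V : ℤ ⥤ ModuleCat.{u} F) (S : Set ℤ) : Submodule F (∀ t, V.obj t) where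
  carrier := {x | (∀ t, t ∉ S → x t = 0) ∧
    ∀ s t (h : s ≤ t), s ∈ S → (V.map (homOfLE h)).hom (x s) = x t}
  add_mem' {x y} hx hy := by
    refine ⟨fun t ht => ?_, fun s t h hs => ?_⟩
    · simp [hx.1 t ht, hy.1 t ht]
    · simp [hx.2 s t h hs, hy.2 s t h hs]
  zero_mem' := ⟨fun _ _ => rfl, fun _ _ _ _ => by simp⟩
  smul_mem' c x hx := by
    refine ⟨fun t ht => ?_, fun s t h hs => ?_⟩
    · simp [hx.1 t ht]
    · simp [hx.2 s t h hs]

theorem map_map_apply (V : ℤ ⥤ ModuleCat.{u} F) {r s t : ℤ} (h : r ≤ s) (h' : s ≤ t)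
    (v : V.obj r) : (V.map (homOfLE h')).hom ((V.map (homOfLE h)).hom v) =
      (V.map (homOfLE (h.trans h'))).hom v := by
  rw [← homOfLE_comp h h', V.map_comp]; rfl

theorem map_refl_apply (V : ℤ ⥤ ModuleCat.{u} F) {r : ℤ} (h : r ≤ r)
    (v : V.obj r) : (V.map (homOfLE h)).hom v = v := by
  have : homOfLE h = 𝟙 r := rfl
  rw [this, V.map_id]; rfl

theorem naturality_apply {V W : ℤ ⥤ ModuleCat.{u} F} (Φ : V ⟶ W) {s t : ℤ} (h : s ≤ t)
    (v : V.obj s) : (Φ.app t).hom ((V.map (homOfLE h)).hom v) =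
      (W.map (homOfLE h)).hom ((Φ.app s).hom v) := by
  exact congrArg (fun f => f.hom v) (Φ.naturality (homOfLE h))

/-- `x` is a basis of `V` adapted to an interval decomposition with supports `S`. -/
structure IsIntervalBasis {ι : Type} [Fintype ι] (V : ℤ ⥤ ModuleCat.{u} F) (S : ι → Set ℤ)
    (x : ι → ∀ t, V.obj t) : Prop where
  mem (i : ι) : x i ∈ sectionsOn V (S i)
  span (t : ℤ) : ⊤ ≤ Submodule.span F (Set.range fun i => x i t)
  -- Together with spanning, this count yields linear independence of the vectors alive at t. Empty
  -- supports are allowed, which lets `I⁺` and `I⁻` fit the same format.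
  card (t : ℤ) : Nat.card {i // t ∈ S i} = Module.finrank F (V.obj t)

namespace IsIntervalBasis

variable {ι : Type} [Fintype ι] {V : ℤ ⥤ ModuleCat.{u} F} {S : ι → Set ℤ} {x : ι → ∀ t, V.obj t}

theorem apply_eq_zero (h : IsIntervalBasis V S x) {i : ι} {t : ℤ} (ht : t ∉ S i) : x i t = 0 :=
  (h.mem i).1 t ht

theorem map_apply (h : IsIntervalBasis V S x) {i : ι} {s t : ℤ} (hst : s ≤ t) (hs : s ∈ S i) :
    (V.map (homOfLE hst)).hom (x i s) = x i t :=
  (h.mem i).2 s t hst hs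

theorem top_le_span_subtype (h : IsIntervalBasis V S x) (t : ℤ) :
    ⊤ ≤ Submodule.span F (Set.range fun i : {i // t ∈ S i} => x i t) := by
  refine (h.span t).trans (Submodule.span_le.2 ?_)
  rintro _ ⟨i, rfl⟩
  by_cases hi : t ∈ S i
  · exact Submodule.subset_span ⟨⟨i, hi⟩, rfl⟩
  · simp [h.apply_eq_zero hi]

open Classical in
/-- The basis of `V_t` formed by the vectors whose support contains `t`. -/
noncomputable def basis (h : IsIntervalBasis V S x) (t : ℤ) :
    Module.Basis {i // t ∈ S i} F (V.obj t) :=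
  basisOfTopLeSpanOfCardEqFinrank (fun i : {i // t ∈ S i} => x i t) (h.top_le_span_subtype t)
    (by rw [← h.card t, Nat.card_eq_fintype_card])

@[simp] theorem basis_apply (h : IsIntervalBasis V S x) (t : ℤ) (i : {i // t ∈ S i}) :
    h.basis t i = x i t := by
  simp [basis]

open Classical in
/-- The coordinate functionals of an interval basis. -/
noncomputable def coord (h : IsIntervalBasis V S x) (i : ι) (t : ℤ) : V.obj t →ₗ[F] F :=
  if ht : t ∈ S i then (h.basis t).coord ⟨i, ht⟩ else 0

theorem coord_eq_zero (h : IsIntervalBasis V S x) {i : ι} {t : ℤ} (ht : t ∉ S i) (v : V.obj t) :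
    h.coord i t v = 0 := by
  simp [coord, ht]

theorem mem_of_coord_ne_zero (h : IsIntervalBasis V S x) {i : ι} {t : ℤ} {v : V.obj t}
    (hv : h.coord i t v ≠ 0) : t ∈ S i := by
  by_contra ht
  exact hv (h.coord_eq_zero ht v)

theorem sum_coord (h : IsIntervalBasis V S x) (t : ℤ) (v : V.obj t) :
    ∑ i, h.coord i t v • x i t = v := by
  classical
  conv_rhs => rw [← (h.basis t).sum_repr v]
  rw [← Finset.sum_subset (Finset.subset_univ (Finset.univ.filter fun i => t ∈ S i)),
    ← Finset.sum_subtype_eq_sum_filter, Finset.subtype_univ]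
  · refine Finset.sum_congr rfl fun i _ => ?_
    rw [basis_apply]
    simp [coord, i.2]
  · intro i _ hi
    rw [h.coord_eq_zero (by simpa using hi), zero_smul]

open Classical in
theorem coord_apply (h : IsIntervalBasis V S x) (i j : ι) (t : ℤ) :
    h.coord i t (x j t) = if t ∈ S i ∧ i = j then 1 else 0 := by
  by_cases ht : t ∈ S i
  · by_cases hj : t ∈ S j
    · have : x j t = h.basis t ⟨j, hj⟩ := by simp
      simp only [coord, ht, dite_true, this, Module.Basis.coord_apply, Module.Basis.repr_self,
        true_and]
      rw [Finsupp.single_apply]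
      simp [eq_comm]
    · rw [h.apply_eq_zero hj, map_zero, if_neg]
      rintro ⟨h1, rfl⟩
      exact hj h1
  · simp [h.coord_eq_zero ht, ht]

theorem coord_sum (h : IsIntervalBasis V S x) {i : ι} {t : ℤ} (ht : t ∈ S i) (a : ι → F) :
    h.coord i t (∑ j, a j • x j t) = a i := by
  classical
  simp [map_sum, coord_apply, ht]

/-- Inner morphisms send x j to x j or to 0, so no other bar contributes to coordinate i. This also
covers s outside the support of i, where both sides vanish; it is the main source of endpoint
inequalities below. -/
theorem coord_map (h : IsIntervalBasis V S x) {i : ι} {s t : ℤ} (hst : s ≤ t) (ht : t ∈ S i)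
    (v : V.obj s) : h.coord i t ((V.map (homOfLE hst)).hom v) = h.coord i s v := by
  conv_lhs => rw [← h.sum_coord s v]
  rw [map_sum, ← h.coord_sum ht fun j => h.coord j s v]
  congr 1
  refine Finset.sum_congr rfl fun j _ => ?_
  rw [map_smul]
  by_cases hj : s ∈ S j
  · rw [h.map_apply hst hj]
  · rw [h.coord_eq_zero hj, zero_smul, zero_smul]

theorem finite (h : IsIntervalBasis V S x) (t : ℤ) : Module.Finite F (V.obj t) :=
  Module.Basis.finiteDimensional_of_finite (h.basis t)

theorem of_mem_span (h : IsIntervalBasis V S x) {x' : ι → ∀ t, V.obj t}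
    (hmem : ∀ i, x' i ∈ sectionsOn V (S i))
    (hspan : ∀ i t, x i t ∈ Submodule.span F (Set.range fun i => x' i t)) :
    IsIntervalBasis V S x' where
  mem := hmem
  span t := (h.span t).trans (Submodule.span_le.2 (by rintro _ ⟨i, rfl⟩; exact hspan i t))
  card := h.card

theorem congr_supports (h : IsIntervalBasis V S x) {S' : ι → Set ℤ} (hS : ∀ i, S i = S' i) :
    IsIntervalBasis V S' x := by
  obtain rfl : S = S' := funext hS
  exact h

/-- An isomorphism carries interval bases to interval bases. -/
theorem map_iso (h : IsIntervalBasis V S x) {W : ℤ ⥤ ModuleCat.{u} F} (e : V ≅ W) :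
    IsIntervalBasis W S fun i t => (e.hom.app t).hom (x i t) where
  mem i := ⟨fun t ht => by simp [h.apply_eq_zero ht], fun s t hst hs => by
    rw [← naturality_apply, h.map_apply hst hs]⟩
  span t := by
    have hs : Function.Surjective (e.hom.app t).hom := fun w =>
      ⟨(e.inv.app t).hom w, by
        simp⟩
    have : (Set.range fun i => (e.hom.app t).hom (x i t)) =
        (e.hom.app t).hom '' Set.range fun i => x i t := by
      rw [← Set.range_comp]; rfl
    rw [this, ← Submodule.map_span, top_le_iff.1 (h.span t), Submodule.map_top,
      LinearMap.range_eq_top.2 hs]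
  card t := by
    rw [h.card t]
    exact LinearEquiv.finrank_eq (e.app t).toLinearEquiv

/-- The shift of an interval basis. -/
theorem shift (h : IsIntervalBasis V S x) (d : ℤ) :
    IsIntervalBasis (Ladder.shift d V) (fun i => {t | t + d ∈ S i}) fun i t => x i (t + d) where
  mem i := ⟨fun _ ht => (h.mem i).1 _ ht,
    fun _ _ hst hs => (h.mem i).2 _ _ (Int.add_le_add_right hst d) hs⟩
  span t := h.span (t + d)
  card t := h.card (t + d)

/-- Two persistence modules having interval bases with the same supports are isomorphic. -/
theorem exists_iso (h : IsIntervalBasis V S x) {W : ℤ ⥤ ModuleCat.{u} F}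
    {y : ι → ∀ t, W.obj t} (h' : IsIntervalBasis W S y) :
    ∃ e : V ≅ W, ∀ i t, (e.hom.app t).hom (x i t) = y i t := by
  let e (t : ℤ) : V.obj t ≃ₗ[F] W.obj t := (h.basis t).equiv (h'.basis t) (Equiv.refl _)
  have he (i : ι) (t : ℤ) : e t (x i t) = y i t := by
    by_cases ht : t ∈ S i
    · have h1 := (h.basis t).equiv_apply ⟨i, ht⟩ (h'.basis t) (Equiv.refl _)
      simpa using h1
    · rw [h.apply_eq_zero ht, h'.apply_eq_zero ht, map_zero]
  refine ⟨NatIso.ofComponents (fun t => (e t).toModuleIso) ?_, he⟩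
  intro s t f
  have hst := leOfHom f
  apply ModuleCat.hom_ext
  apply (h.basis s).ext
  rintro ⟨i, hi⟩
  rw [h.basis_apply]
  change e t ((V.map (homOfLE hst)).hom (x i s)) = (W.map (homOfLE hst)).hom (e s (x i s))
  rw [h.map_apply hst hi, he, he, h'.map_apply hst hi]

open Classical in
/-- The direct sum of modules generated by one section each. -/
theorem directSum {M : ι → (ℤ ⥤ ModuleCat.{u} F)} {e : ∀ i, ∀ t, (M i).obj t}
    (h : ∀ i, IsIntervalBasis (M i) (fun _ : Unit => S i) fun _ => e i) :
    IsIntervalBasis (Ladder.directSum M) S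
      fun i t => DirectSum.lof F ι (fun i => (M i).obj t) i (e i t) where
  mem i := by
    refine ⟨fun t ht => ?_, fun s t hst hs => ?_⟩
    · change DirectSum.lof F ι (fun i => (M i).obj t) i (e i t) = 0
      rw [(h i).apply_eq_zero (i := ()) ht, map_zero]
    · change DirectSum.lmap (fun i => ((M i).map (homOfLE hst)).hom) (DirectSum.lof F ι _ i _) = _
      rw [DirectSum.lmap_lof, (h i).map_apply (i := ()) hst hs]
  span t := by
    intro v _
    change DirectSum ι fun i => (M i).obj t at v
    induction v using DirectSum.induction_on with
    | zero => exact zero_mem _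
    | of i z =>
      obtain ⟨c, rfl⟩ : ∃ c : F, c • e i t = z := by
        have := (h i).span t (Submodule.mem_top (x := z))
        rw [Set.range_const] at this
        exact Submodule.mem_span_singleton.1 this
      have hm : DirectSum.lof F ι (fun i => (M i).obj t) i (e i t) ∈ Submodule.span F
          (Set.range fun i => DirectSum.lof F ι (fun i => (M i).obj t) i (e i t)) :=
        Submodule.subset_span ⟨i, rfl⟩
      have := Submodule.smul_mem _ c hm
      rw [← map_smul] at this
      exact this
    | add v w hv hw => exact add_mem (hv trivial) (hw trivial)
  card t := by
    have (i : ι) : Module.Finite F ((M i).obj t) := (h i).finite t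
    have h1 : Module.finrank F ((Ladder.directSum M).obj t) =
        ∑ i, Module.finrank F ((M i).obj t) := Module.finrank_directSum F _
    rw [h1, Nat.card_eq_fintype_card, Fintype.card_subtype, Finset.card_filter]
    refine Finset.sum_congr rfl fun i _ => ?_
    rw [← (h i).card t]
    by_cases hi : t ∈ S i <;> simp [hi]

/-- A family of vectors independent modulo the coordinates in `T` has at most `|T|` members. -/
theorem card_le_of_independent (h : IsIntervalBasis V S x) {t : ℤ} {M : Type} [Fintype M]
    (z : M → V.obj t) (T : Set ι)
    (hz : ∀ c : M → F, (∀ i ∈ T, h.coord i t (∑ m, c m • z m) = 0) → c = 0) :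
    Nat.card M ≤ Nat.card T := by
  classical
  let f : (M → F) →ₗ[F] (T → F) := LinearMap.pi fun i => h.coord i t ∘ₗ Fintype.linearCombination F z
  have hf : Function.Injective f := by
    rw [← LinearMap.ker_eq_bot, LinearMap.ker_eq_bot']
    intro c hc
    refine hz c fun i hi => ?_
    have := congrFun hc ⟨i, hi⟩
    simpa [f, Fintype.linearCombination_apply] using this
  have := LinearMap.finrank_le_finrank_of_injective hf
  simpa [Nat.card_eq_fintype_card] using this

end IsIntervalBasis

/-- The set of indices in a bar. -/
def Bar.support (J : Bar) : Set ℤ := Set.Icc J.fst J.snd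

theorem Bar.mem_support {J : Bar} {t : ℤ} : t ∈ J.support ↔ J.fst ≤ t ∧ t ≤ J.snd := Iff.rfl

theorem Bar.fst_mem_support (J : Bar) : J.fst ∈ J.support := ⟨le_rfl, J.fst_le_snd⟩

theorem Bar.support_injective : Function.Injective Bar.support := by
  intro J K h
  have h1 : J.fst ∈ K.support := h ▸ J.fst_mem_support
  have h2 : K.fst ∈ J.support := h ▸ K.fst_mem_support
  have h3 : J.snd ∈ K.support := h ▸ (⟨J.fst_le_snd, le_rfl⟩ : J.snd ∈ J.support)
  have h4 : K.snd ∈ J.support := h ▸ (⟨K.fst_le_snd, le_rfl⟩ : K.snd ∈ K.support)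
  rw [Bar.mem_support] at h1 h2 h3 h4
  exact NonemptyInterval.ext (Prod.ext (by lia) (by lia))

namespace ElementaryLadder

/-- The support of the source of an elementary ladder module. -/
def srcSupport : ElementaryLadder → Set ℤ
  | R J _ _ => J.support
  | Iplus J => J.support
  | Iminus _ => ∅

/-- The support of the target of an elementary ladder module. -/
def tgtSupport : ElementaryLadder → Set ℤ
  | R _ K _ => K.support
  | Iplus _ => ∅
  | Iminus K => K.support

end ElementaryLadder

theorem top_le_span_const_one (F : Type u) [Field F] (p : Prop) :
    (⊤ : Submodule F (PLift p → F)) ≤ Submodule.span F (Set.range fun _ : Unit => fun _ => 1) := by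
  intro f _
  rw [Set.range_const]
  apply Submodule.mem_span_singleton.2
  by_cases hp : p
  · exact ⟨f ⟨hp⟩, funext fun _ => mul_one _⟩
  · exact ⟨0, funext fun h => absurd h.1 hp⟩

theorem intervalModule_isIntervalBasis (J : Bar) :
    IsIntervalBasis (intervalModule F J) (fun _ : Unit => J.support)
      fun _ _ => (fun _ => (1 : F)) where
  mem _ := by
    refine ⟨fun t ht => ?_, fun s t hst hs => ?_⟩
    · funext ⟨h⟩
      exact absurd h ht
    · funext ⟨h⟩
      change idOrZero F (s ∈ J) (t ∈ J) (fun _ => 1) ⟨h⟩ = 1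
      simp only [idOrZero, LinearMap.coe_mk, AddHom.coe_mk, dite_eq_ite, ite_eq_left_iff]
      exact fun h' => absurd hs h'
  span t := top_le_span_const_one F (t ∈ J)
  card t := by
    classical
    change _ = Module.finrank F (PLift (t ∈ J) → F)
    rw [Module.finrank_fintype_fun_eq_card, ← Nat.card_eq_fintype_card]
    by_cases ht : t ∈ J
    · have ht' : t ∈ J.support := ht
      have : Unique (PLift (t ∈ J)) := ⟨⟨⟨ht⟩⟩, fun _ => rfl⟩
      simp [ht']
    · have ht' : t ∉ J.support := ht
      have : IsEmpty (PLift (t ∈ J)) := ⟨fun h => ht h.1⟩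
      simp [ht']

theorem const_punit_isIntervalBasis :
    IsIntervalBasis ((Functor.const ℤ).obj (ModuleCat.of F PUnit.{u + 1}))
      (fun _ : Unit => ∅) fun _ _ => 0 where
  mem _ := zero_mem _
  span t := fun (_ : PUnit) _ => zero_mem _
  card t := by
    change _ = Module.finrank F PUnit.{u + 1}
    simp [Module.finrank_zero_of_subsingleton]

namespace ElementaryLadder

theorem exists_generator (E : ElementaryLadder) :
    ∃ (a : ∀ t, (E.toArrow F).left.obj t) (b : ∀ t, (E.toArrow F).right.obj t),
      IsIntervalBasis (E.toArrow F).left (fun _ : Unit => E.srcSupport) (fun _ => a) ∧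
      IsIntervalBasis (E.toArrow F).right (fun _ : Unit => E.tgtSupport) (fun _ => b) ∧
      ∀ t ∈ E.srcSupport, ((E.toArrow F).hom.app t).hom (a t) = b t := by
  cases E with
  | R J K h =>
    refine ⟨_, _, intervalModule_isIntervalBasis J, intervalModule_isIntervalBasis K, ?_⟩
    intro t ht
    funext ⟨h⟩
    change idOrZero F (t ∈ J) (t ∈ K) (fun _ => 1) ⟨h⟩ = 1
    simp only [idOrZero, LinearMap.coe_mk, AddHom.coe_mk, dite_eq_ite, ite_eq_left_iff]
    exact fun h' => absurd ht h'
  | Iplus J =>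
    exact ⟨_, _, intervalModule_isIntervalBasis J, const_punit_isIntervalBasis, fun _ _ => rfl⟩
  | Iminus K =>
    exact ⟨_, _, const_punit_isIntervalBasis, intervalModule_isIntervalBasis K,
      fun _ h => absurd h (Set.notMem_empty _)⟩

end ElementaryLadder

/-! ### Ladder bases -/

/-- Interval bases of `V` and `W` adapted to a ladder decomposition of `Φ : V ⟶ W`. -/
structure IsLadderBasis {ι : Type} [Fintype ι] {V W : ℤ ⥤ ModuleCat.{u} F} (Φ : V ⟶ W)
    (E : ι → ElementaryLadder) (x : ι → ∀ t, V.obj t) (y : ι → ∀ t, W.obj t) : Prop where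
  left : IsIntervalBasis V (fun i => (E i).srcSupport) x
  right : IsIntervalBasis W (fun i => (E i).tgtSupport) y
  app_eq (i : ι) (t : ℤ) (ht : t ∈ (E i).srcSupport) : (Φ.app t).hom (x i t) = y i t

theorem exists_isLadderBasis_directSumMap {ι : Type} [Fintype ι] (E : ι → ElementaryLadder) :
    ∃ x y, IsLadderBasis (directSumMap fun i => ((E i).toArrow F).hom) E x y := by
  classical
  choose a b ha hb hab using fun i => (E i).exists_generator (F := F)
  refine ⟨_, _, IsIntervalBasis.directSum ha, IsIntervalBasis.directSum hb, fun i t ht => ?_⟩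
  change DirectSum.lmap (fun i => (((E i).toArrow F).hom.app t).hom) (DirectSum.lof F ι _ i _) = _
  rw [DirectSum.lmap_lof, hab i t ht]

/-- This replaces isomorphisms of arrows by pairs of compatible bases, the only form used in the
sequel. -/
theorem isLadderDecomposition_iff {V W : ℤ ⥤ ModuleCat.{u} F} {Φ : V ⟶ W}
    {L : Multiset ElementaryLadder} :
    IsLadderDecomposition Φ L ↔ ∃ (ι : Type) (_ : Fintype ι) (E : ι → ElementaryLadder)
      (x : ι → ∀ t, V.obj t) (y : ι → ∀ t, W.obj t),
      Finset.univ.val.map E = L ∧ IsLadderBasis Φ E x y := by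
  classical
  constructor
  · rintro ⟨ι, _, E, hE, ⟨e⟩⟩
    obtain ⟨x, y, h⟩ := exists_isLadderBasis_directSumMap (F := F) E
    refine ⟨ι, _, E, _, _, hE, h.left.map_iso (Arrow.leftFunc.mapIso e.symm),
      h.right.map_iso (Arrow.rightFunc.mapIso e.symm), fun i t ht => ?_⟩
    rw [← h.app_eq i t ht]
    have h1 := congrArg (fun f => (f.app t).hom (x i t)) (Arrow.w e.inv)
    exact h1
  · rintro ⟨ι, _, E, x', y', hE, h'⟩
    obtain ⟨x, y, h⟩ := exists_isLadderBasis_directSumMap (F := F) E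
    obtain ⟨l, hl⟩ := h'.left.exists_iso h.left
    obtain ⟨r, hr⟩ := h'.right.exists_iso h.right
    refine ⟨ι, _, E, hE, ⟨Arrow.isoMk l r ?_⟩⟩
    apply NatTrans.ext
    funext t
    apply ModuleCat.hom_ext
    apply (h'.left.basis t).ext
    intro i
    rw [h'.left.basis_apply]
    change ((directSumMap fun i => ((E i).toArrow F).hom).app t).hom ((l.hom.app t).hom (x' i t)) =
      (r.hom.app t).hom ((Φ.app t).hom (x' i t))
    rw [hl, h.app_eq i t i.2, h'.app_eq i t i.2, hr]

/-- Interval decompositions, in terms of bases. -/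
theorem isBarcode_iff {V : ℤ ⥤ ModuleCat.{u} F} {B : Multiset Bar} :
    IsBarcode V B ↔ ∃ (ι : Type) (_ : Fintype ι) (J : ι → Bar) (x : ι → ∀ t, V.obj t),
      Finset.univ.val.map J = B ∧ IsIntervalBasis V (fun i => (J i).support) x := by
  classical
  constructor
  · rintro ⟨ι, _, J, hJ, ⟨e⟩⟩
    exact ⟨ι, _, J, _, hJ, (IsIntervalBasis.directSum fun i =>
      intervalModule_isIntervalBasis (F := F) (J i)).map_iso e.symm⟩
  · rintro ⟨ι, _, J, x, hJ, h⟩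
    obtain ⟨e, -⟩ := h.exists_iso (IsIntervalBasis.directSum fun i =>
      intervalModule_isIntervalBasis (F := F) (J i))
    exact ⟨ι, _, J, hJ, ⟨e⟩⟩

namespace IsLadderBasis

variable {ι : Type} [Fintype ι] {V W : ℤ ⥤ ModuleCat.{u} F}
    {Φ : V ⟶ W} {E : ι → ElementaryLadder} {x : ι → ∀ t, V.obj t} {y : ι → ∀ t, W.obj t}

theorem app_sum (h : IsLadderBasis Φ E x y) {t : ℤ} (a : ι → F)
    (ha : ∀ i, a i ≠ 0 → t ∈ (E i).srcSupport) :
    (Φ.app t).hom (∑ i, a i • x i t) = ∑ i, a i • y i t := by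
  rw [map_sum]
  refine Finset.sum_congr rfl fun i _ => ?_
  rw [map_smul]
  by_cases hi : a i = 0
  · simp [hi]
  · rw [h.app_eq i t (ha i hi)]

theorem app_eq_sum (h : IsLadderBasis Φ E x y) {t : ℤ} (v : V.obj t) :
    (Φ.app t).hom v = ∑ i, h.left.coord i t v • y i t := by
  conv_lhs => rw [← h.left.sum_coord t v]
  exact h.app_sum _ fun i hi => h.left.mem_of_coord_ne_zero hi

/-- At t outside the source support both sides are 0: y i is then not hit by Φ. -/
theorem coord_app (h : IsLadderBasis Φ E x y) {i : ι} {t : ℤ} (ht : t ∈ (E i).tgtSupport)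
    (v : V.obj t) : h.right.coord i t ((Φ.app t).hom v) = h.left.coord i t v := by
  rw [h.app_eq_sum, h.right.coord_sum ht]

end IsLadderBasis

/-! ### Windows -/

/-- The vectors of `V_t` which come from `V_a` and vanish in `V_u`. -/
noncomputable def window (V : ℤ ⥤ ModuleCat.{u} F) {a t u : ℤ} (h₁ : a ≤ t) (h₂ : t ≤ u) :
    Submodule F (V.obj t) :=
  LinearMap.range (V.map (homOfLE h₁)).hom ⊓ LinearMap.ker (V.map (homOfLE h₂)).hom

/-- The span of the bars containing `t` which are at most `J` in the product order. -/
noncomputable def windowLE (V : ℤ ⥤ ModuleCat.{u} F) {J : Bar} {t : ℤ} (h : t ∈ J.support) :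
    Submodule F (V.obj t) :=
  window V h.1 (h.2.trans (Int.lt_add_one_of_le le_rfl).le)

/-- The span of the bars containing `t` which are smaller than `J` in the product order. -/
noncomputable def windowLT (V : ℤ ⥤ ModuleCat.{u} F) {J : Bar} {t : ℤ} (h : t ∈ J.support) :
    Submodule F (V.obj t) :=
  window V ((Int.sub_one_lt_of_le le_rfl).le.trans h.1)
      (h.2.trans (Int.lt_add_one_of_le le_rfl).le) ⊔
    window V h.1 h.2

/-- The supports of bars, and the empty set. -/
def IsBarSupport (S : Set ℤ) : Prop := S = ∅ ∨ ∃ J : Bar, S = J.support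

theorem ElementaryLadder.isBarSupport_srcSupport (E : ElementaryLadder) :
    IsBarSupport E.srcSupport := by
  cases E
  · exact Or.inr ⟨_, rfl⟩
  · exact Or.inr ⟨_, rfl⟩
  · exact Or.inl rfl

theorem ElementaryLadder.isBarSupport_tgtSupport (E : ElementaryLadder) :
    IsBarSupport E.tgtSupport := by
  cases E
  · exact Or.inr ⟨_, rfl⟩
  · exact Or.inl rfl
  · exact Or.inr ⟨_, rfl⟩

theorem IsBarSupport.eq_support {S : Set ℤ} (hS : IsBarSupport S) {J : Bar} (h₁ : J.fst ∈ S)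
    (h₂ : J.snd ∈ S) (h₃ : J.fst - 1 ∉ S) (h₄ : J.snd + 1 ∉ S) : S = J.support := by
  rcases hS with rfl | ⟨K, rfl⟩
  · exact absurd h₁ (Set.notMem_empty _)
  · rw [Bar.mem_support] at h₁ h₂ h₃ h₄
    congr 1
    have := J.fst_le_snd
    exact NonemptyInterval.ext (Prod.ext (by lia) (by lia))

namespace IsIntervalBasis

variable {ι : Type} [Fintype ι] {V : ℤ ⥤ ModuleCat.{u} F} {S : ι → Set ℤ} {x : ι → ∀ t, V.obj t}

/-- The left side mentions no basis, the right side only bars: this is what turns multiplicities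
into invariants. -/
theorem mem_window_iff (h : IsIntervalBasis V S x) {a t u : ℤ} (h₁ : a ≤ t) (h₂ : t ≤ u)
    {v : V.obj t} : v ∈ window V h₁ h₂ ↔ ∀ i, h.coord i t v ≠ 0 → a ∈ S i ∧ u ∉ S i := by
  constructor
  · rintro ⟨⟨v₀, rfl⟩, hv⟩ i hi
    constructor
    · rw [h.coord_map h₁ (h.mem_of_coord_ne_zero hi)] at hi
      exact h.mem_of_coord_ne_zero hi
    · intro hu
      rw [← h.coord_map h₂ hu] at hi
      exact hi (by rw [LinearMap.mem_ker.1 hv, map_zero])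
  · intro hv
    refine ⟨⟨∑ i, h.coord i t v • x i a, ?_⟩, LinearMap.mem_ker.2 ?_⟩
    · conv_rhs => rw [← h.sum_coord t v]
      rw [map_sum]
      refine Finset.sum_congr rfl fun i _ => ?_
      rw [map_smul]
      by_cases hi : h.coord i t v = 0
      · rw [hi, zero_smul, zero_smul]
      · rw [h.map_apply h₁ (hv i hi).1]
    · conv_lhs => rw [← h.sum_coord t v]
      rw [map_sum]
      refine Finset.sum_eq_zero fun i _ => ?_
      rw [map_smul]
      by_cases hi : h.coord i t v = 0
      · rw [hi, zero_smul]
      · rw [h.map_apply h₂ (h.mem_of_coord_ne_zero hi), h.apply_eq_zero (hv i hi).2, smul_zero]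

theorem coord_eq_zero_of_mem_windowLT (h : IsIntervalBasis V S x) {J : Bar} {t : ℤ}
    (ht : t ∈ J.support) {v : V.obj t} (hv : v ∈ windowLT V ht) {i : ι}
    (hi : S i = J.support) : h.coord i t v = 0 := by
  by_contra h0
  obtain ⟨v₁, h₁, v₂, h₂, rfl⟩ := Submodule.mem_sup.1 hv
  rw [h.mem_window_iff] at h₁ h₂
  by_cases h1 : h.coord i t v₁ = 0
  · rw [map_add, h1, zero_add] at h0
    exact (h₂ i h0).2 (by rw [hi, Bar.mem_support]; exact ⟨J.fst_le_snd, le_rfl⟩)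
  · have := (h₁ i h1).1
    rw [hi, Bar.mem_support] at this
    lia

/-- A bar containing `J.fst` but not `J.snd + 1` either contains `J.fst - 1`, or misses `J.snd`, or
equals J; these are the two summands of `windowLT` and the excluded case. -/
theorem mem_windowLT (h : IsIntervalBasis V S x) (hS : ∀ i, IsBarSupport (S i)) {J : Bar} {t : ℤ}
    (ht : t ∈ J.support) {v : V.obj t} (hv : v ∈ windowLE V ht)
    (hv' : ∀ i, S i = J.support → h.coord i t v = 0) : v ∈ windowLT V ht := by
  classical
  rw [windowLE, h.mem_window_iff] at hv
  rw [← h.sum_coord t v]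
  refine Submodule.sum_mem _ fun i _ => ?_
  by_cases hi : h.coord i t v = 0
  · rw [hi, zero_smul]
    exact zero_mem _
  obtain ⟨h1, h2⟩ := hv i hi
  refine Submodule.smul_mem _ _ ?_
  by_cases h3 : J.fst - 1 ∈ S i
  · refine Submodule.mem_sup_left ((h.mem_window_iff _ _).2 fun k hk => ?_)
    rw [h.coord_apply] at hk
    obtain rfl : k = i := by
      by_contra hne
      exact hk (if_neg fun h => hne h.2)
    exact ⟨h3, h2⟩
  · refine Submodule.mem_sup_right ((h.mem_window_iff _ _).2 fun k hk => ?_)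
    rw [h.coord_apply] at hk
    obtain rfl : k = i := by
      by_contra hne
      exact hk (if_neg fun h => hne h.2)
    exact ⟨h1, fun h4 => hi (hv' k ((hS k).eq_support h1 h4 h3 h2))⟩

theorem apply_mem_windowLE (h : IsIntervalBasis V S x) {J : Bar} {t : ℤ} (ht : t ∈ J.support)
    {i : ι} (hi : S i = J.support) : x i t ∈ windowLE V ht := by
  classical
  rw [windowLE, h.mem_window_iff]
  intro k hk
  rw [h.coord_apply] at hk
  obtain rfl : k = i := by
    by_contra hne
    exact hk (if_neg fun h => hne h.2)
  rw [hi, Bar.mem_support, Bar.mem_support]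
  have := J.fst_le_snd
  lia

theorem coord_sum_subtype (h : IsIntervalBasis V S x) {p : ι → Prop} [Fintype {i // p i}] {i : ι} (hi : p i) {t : ℤ}
    (ht : t ∈ S i) (c : {i // p i} → F) :
    h.coord i t (∑ m, c m • x m t) = c ⟨i, hi⟩ := by
  classical
  rw [map_sum, Finset.sum_eq_single ⟨i, hi⟩]
  · simp [coord_apply, ht]
  · rintro ⟨b, hb⟩ - hne
    have : i ≠ b := fun h => hne (Subtype.ext h.symm)
    simp [coord_apply, this]
  · simp

/-- The J-vectors of the first basis stay independent modulo `windowLT`. A combination without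
J-coordinates in the second basis lies in `windowLT`, so its J-coordinates in the first basis vanish
too. -/
theorem card_supports_le (h : IsIntervalBasis V S x) {ι' : Type} [Fintype ι'] {S' : ι' → Set ℤ}
    {x' : ι' → ∀ t, V.obj t} (h' : IsIntervalBasis V S' x') (hS' : ∀ i, IsBarSupport (S' i))
    (J : Bar) : Nat.card {i // S i = J.support} ≤ Nat.card {i // S' i = J.support} := by
  classical
  have ht := J.fst_mem_support
  refine h'.card_le_of_independent (t := J.fst) (fun m : {i // S i = J.support} => x m J.fst)
    {i | S' i = J.support} fun c hc => funext fun m => ?_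
  have hv := h'.mem_windowLT hS' ht (Submodule.sum_mem _ fun m _ => Submodule.smul_mem _ (c m)
    (h.apply_mem_windowLE ht m.2)) hc
  have := h.coord_eq_zero_of_mem_windowLT ht hv m.2
  rwa [h.coord_sum_subtype m.2 (by rw [m.2]; exact ht)] at this

end IsIntervalBasis

namespace ElementaryLadder

theorem eq_R {E : ElementaryLadder} {J K : Bar} (h : K.Overlaps J)
    (h₁ : E.srcSupport = J.support) (h₂ : E.tgtSupport = K.support) : E = R J K h := by
  cases E with
  | R J' K' _ =>
    obtain rfl := Bar.support_injective h₁
    obtain rfl := Bar.support_injective h₂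
    rfl
  | Iplus J' =>
    have : K.fst ∈ (∅ : Set ℤ) := (show K.support = ∅ from h₂.symm) ▸ K.fst_mem_support
    exact absurd this (Set.notMem_empty _)
  | Iminus J' =>
    have : J.fst ∈ (∅ : Set ℤ) := (show J.support = ∅ from h₁.symm) ▸ J.fst_mem_support
    exact absurd this (Set.notMem_empty _)

end ElementaryLadder

namespace IsLadderBasis

variable {ι : Type} [Fintype ι] {V W : ℤ ⥤ ModuleCat.{u} F}
    {Φ : V ⟶ W} {E : ι → ElementaryLadder} {x : ι → ∀ t, V.obj t} {y : ι → ∀ t, W.obj t}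

/-- Deleting the J-coordinates of v gives v₁. What remains of Φ v comes from summands with source J,
and none of these has target K. -/
theorem exists_sub_mem_windowLT (h : IsLadderBasis Φ E x y) {J K : Bar} (hKJ : K.Overlaps J)
    {t : ℤ} (htJ : t ∈ J.support) (htK : t ∈ K.support) {v : V.obj t} (hv : v ∈ windowLE V htJ)
    (hΦv : (Φ.app t).hom v ∈ windowLE W htK)
    (hR : ∀ i, E i = .R J K hKJ → h.right.coord i t ((Φ.app t).hom v) = 0) :
    ∃ v₁ ∈ windowLT V htJ, (Φ.app t).hom v - (Φ.app t).hom v₁ ∈ windowLT W htK := by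
  classical
  have hv' := hv
  have hΦv' := hΦv
  rw [windowLE, h.left.mem_window_iff] at hv'
  rw [windowLE, h.right.mem_window_iff] at hΦv'
  set a : ι → F := fun i => if (E i).srcSupport = J.support then 0 else h.left.coord i t v with ha
  have ha' (i : ι) (hi : a i ≠ 0) :
      (E i).srcSupport ≠ J.support ∧ h.left.coord i t v ≠ 0 := by
    by_cases h1 : (E i).srcSupport = J.support
    · simp [ha, h1] at hi
    · simpa [ha, h1] using hi
  have hat (i : ι) (hi : a i ≠ 0) : t ∈ (E i).srcSupport :=
    h.left.mem_of_coord_ne_zero (ha' i hi).2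
  have hca (i : ι) : h.left.coord i t (∑ i, a i • x i t) = a i := by
    by_cases hi : t ∈ (E i).srcSupport
    · rw [h.left.coord_sum hi]
    · rw [h.left.coord_eq_zero hi]
      by_contra h0
      exact hi (hat i (Ne.symm h0))
  refine ⟨∑ i, a i • x i t, ?_, ?_⟩
  · refine h.left.mem_windowLT (fun i => (E i).isBarSupport_srcSupport) htJ ?_ ?_
    · rw [windowLE, h.left.mem_window_iff]
      intro i hi
      rw [hca] at hi
      exact hv' i (ha' i hi).2
    · intro i hi
      rw [hca, ha]
      simp [hi]
  · have key (i : ι) (hi : h.right.coord i t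
        ((Φ.app t).hom v - (Φ.app t).hom (∑ i, a i • x i t)) ≠ 0) :
        (E i).srcSupport = J.support ∧ h.right.coord i t ((Φ.app t).hom v) ≠ 0 := by
      have hti := h.right.mem_of_coord_ne_zero hi
      rw [map_sub, h.coord_app hti, h.coord_app hti, hca] at hi
      rw [h.coord_app hti]
      by_cases h1 : (E i).srcSupport = J.support
      · simpa [ha, h1] using hi
      · simp [ha, h1] at hi
    refine h.right.mem_windowLT (fun i => (E i).isBarSupport_tgtSupport) htK ?_ ?_
    · rw [windowLE, h.right.mem_window_iff]
      exact fun i hi => hΦv' i (key i hi).2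
    · intro i hi
      by_contra h0
      obtain ⟨h1, h2⟩ := key i h0
      exact h2 (hR i (ElementaryLadder.eq_R hKJ h1 hi))

/-- A combination of target vectors of the `R J K` of the first basis with no such coordinates in
the second lies in Φ(`windowLT V`) + `windowLT W`. Reading coordinates in the first basis, where
both parts contribute 0, shows that it is trivial. -/
theorem card_R_le (h : IsLadderBasis Φ E x y) {ι' : Type} [Fintype ι'] {E' : ι' → ElementaryLadder}
    {x' : ι' → ∀ t, V.obj t} {y' : ι' → ∀ t, W.obj t} (h' : IsLadderBasis Φ E' x' y')
    {J K : Bar} (hKJ : K.Overlaps J) :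
    Nat.card {i // E i = .R J K hKJ} ≤ Nat.card {i // E' i = .R J K hKJ} := by
  classical
  have htJ := J.fst_mem_support
  have htK : J.fst ∈ K.support := ⟨hKJ.1, hKJ.2.1⟩
  have hsrc (m : {i // E i = .R J K hKJ}) : (E m).srcSupport = J.support := by rw [m.2]; rfl
  have htgt (m : {i // E i = .R J K hKJ}) : (E m).tgtSupport = K.support := by rw [m.2]; rfl
  refine h'.right.card_le_of_independent (t := J.fst)
    (fun m : {i // E i = .R J K hKJ} => y m J.fst)
    {i | E' i = .R J K hKJ} fun c hc => funext fun m => ?_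
  have hΦ : (Φ.app J.fst).hom (∑ m, c m • x m J.fst) = ∑ m, c m • y m J.fst := by
    rw [map_sum]
    refine Finset.sum_congr rfl fun m _ => ?_
    rw [map_smul, h.app_eq _ _ (by rw [hsrc]; exact htJ)]
  have hx : ∑ m, c m • x m J.fst ∈ windowLE V htJ := Submodule.sum_mem _ fun m _ =>
    Submodule.smul_mem _ (c m) (h.left.apply_mem_windowLE htJ (hsrc m))
  have hy : ∑ m, c m • y m J.fst ∈ windowLE W htK := Submodule.sum_mem _ fun m _ =>
    Submodule.smul_mem _ (c m) (h.right.apply_mem_windowLE htK (htgt m))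
  rw [← hΦ] at hc hy
  obtain ⟨v₁, hv₁, hw⟩ := h'.exists_sub_mem_windowLT hKJ htJ htK hx hy hc
  have h1 := h.right.coord_eq_zero_of_mem_windowLT htK hw (htgt m)
  have htm : J.fst ∈ (E m).tgtSupport := by rw [htgt]; exact htK
  rw [map_sub, h.coord_app htm, h.coord_app htm,
    h.left.coord_eq_zero_of_mem_windowLT htJ hv₁ (hsrc m), sub_zero,
    h.left.coord_sum_subtype m.2 (by rw [hsrc]; exact htJ)] at h1
  exact h1

end IsLadderBasis

/-! ### Existence and uniqueness of interval decompositions -/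

theorem finrank_inf_ker_add_one {M : Type*} [AddCommGroup M] [Module F M] [Module.Finite F M]
    (U : Submodule F M) (g : M →ₗ[F] F) {x : M} (hx : x ∈ U) (hgx : g x = 1) :
    Module.finrank F ↥(U ⊓ LinearMap.ker g) + 1 = Module.finrank F U ∧
      U ⊓ LinearMap.ker g ⊔ Submodule.span F {x} = U := by
  have hx0 : x ≠ 0 := by
    rintro rfl
    simp at hgx
  have hsup : U ⊓ LinearMap.ker g ⊔ Submodule.span F {x} = U := by
    refine le_antisymm (sup_le inf_le_left ((Submodule.span_singleton_le_iff_mem _ _).2 hx)) ?_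
    intro v hv
    refine Submodule.mem_sup.2 ⟨v - g v • x, ⟨sub_mem hv (U.smul_mem _ hx), ?_⟩, g v • x,
      Submodule.smul_mem _ _ (Submodule.mem_span_singleton_self x), by simp⟩
    simp [hgx]
  have hinf : U ⊓ LinearMap.ker g ⊓ Submodule.span F {x} = ⊥ := by
    rw [eq_bot_iff]
    rintro v ⟨⟨-, hv⟩, hv'⟩
    obtain ⟨c, rfl⟩ := Submodule.mem_span_singleton.1 hv'
    have : c = 0 := by simpa [hgx] using hv
    simp [this]
  have := Submodule.finrank_sup_add_finrank_inf_eq (U ⊓ LinearMap.ker g) (Submodule.span F {x})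
  rw [hsup, hinf, finrank_bot, finrank_span_singleton hx0] at this
  exact ⟨by lia, hsup⟩

-- Bars are split off a submodule U one at a time, by induction on its total dimension. Working
-- inside a fixed V avoids transporting the construction to quotients or complements.
open Classical in
theorem exists_sectionsOn_span_eq (V : ℤ ⥤ ModuleCat.{u} F)
    (hfin : ∀ t, Module.Finite F (V.obj t)) (a b : ℤ) (n : ℕ) (U : ∀ t, Submodule F (V.obj t))
    (hU : ∀ s t (h : s ≤ t), ∀ v ∈ U s, (V.map (homOfLE h)).hom v ∈ U t)
    (hab : ∀ t ∉ Set.Icc a b, U t = ⊥)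
    (hn : ∑ t ∈ Finset.Icc a b, Module.finrank F (U t) = n) :
    ∃ (ι : Type) (_ : Fintype ι) (J : ι → Bar) (x : ι → ∀ t, V.obj t),
      (∀ i, x i ∈ sectionsOn V (J i).support) ∧
      (∀ t, Submodule.span F (Set.range fun i => x i t) = U t) ∧
      ∀ t, (∑ i, if t ∈ (J i).support then 1 else 0) = Module.finrank F (U t) := by
  induction n using Nat.strong_induction_on generalizing U with
  | _ n ih =>
  by_cases hbot : ∀ t, U t = ⊥
  · refine ⟨Empty, inferInstance, Empty.elim, fun i => i.elim, fun i => i.elim, fun t => ?_,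
      fun t => ?_⟩
    · rw [hbot, Set.range_eq_empty, Submodule.span_empty]
    · rw [hbot, finrank_bot, Fintype.sum_empty]
  push Not at hbot
  -- Minimality of l is essential: below l the kernel of the functional g might be proper in U, with
  -- no copy of x to make up for it.
  obtain ⟨l, hl, hlmin⟩ := Int.exists_least_of_bdd (P := fun t => U t ≠ ⊥) ⟨a, fun t ht => by
    by_contra hlt
    exact ht (hab t fun h => hlt h.1)⟩ hbot
  obtain ⟨x₀, hx₀, hx₀0⟩ := (Submodule.ne_bot_iff _).1 hl
  have hlow (t : ℤ) (ht : t < l) : U t = ⊥ := by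
    by_contra h
    exact absurd (hlmin t h) (not_le.2 ht)
  obtain ⟨m, ⟨hlm, hm⟩, hmmax⟩ := Int.exists_greatest_of_bdd
    (P := fun t => ∃ h : l ≤ t, (V.map (homOfLE h)).hom x₀ ≠ 0) ⟨b, fun t ⟨h, ht⟩ => by
      by_contra hlt
      have := hU l t h x₀ hx₀
      rw [hab t fun h => hlt h.2] at this
      exact ht ((Submodule.mem_bot F).1 this)⟩ ⟨l, le_rfl, by rwa [map_refl_apply]⟩
  set x : ∀ t, V.obj t := fun t => if h : l ≤ t then (V.map (homOfLE h)).hom x₀ else 0 with hxdef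
  have hxU (t : ℤ) : x t ∈ U t := by
    by_cases h : l ≤ t
    · simpa [hxdef, h] using hU l t h x₀ hx₀
    · simp [hxdef, h]
  have hxmap (s t : ℤ) (h : s ≤ t) (hs : l ≤ s) : (V.map (homOfLE h)).hom (x s) = x t := by
    simp only [hxdef, hs, hs.trans h, dite_true]
    exact map_map_apply V hs h x₀
  set J : Bar := ⟨(l, m), hlm⟩
  have hxJ : x ∈ sectionsOn V J.support := by
    refine ⟨fun t ht => ?_, fun s t h hs => hxmap s t h hs.1⟩
    by_cases h : l ≤ t
    · have hmt : ¬ t ≤ m := fun h' => ht ⟨h, h'⟩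
      simp only [hxdef, h, dite_true]
      by_contra h0
      exact hmt (hmmax t ⟨h, h0⟩)
    · simp [hxdef, h]
  have hxm : x m ≠ 0 := by simpa [hxdef, hlm] using hm
  -- A functional at the death index m, pulled back to all t ≤ m, equals 1 along x; its kernel is an
  -- invariant complement of x in U.
  obtain ⟨f, hf⟩ : ∃ f : V.obj m →ₗ[F] F, f (x m) = 1 := by
    have h1 := mt (Module.forall_dual_apply_eq_zero_iff F (x m)).1 hxm
    push Not at h1
    obtain ⟨f, hf⟩ := h1
    exact ⟨(f (x m))⁻¹ • f, by simp [hf]⟩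
  set g : ∀ t, V.obj t →ₗ[F] F := fun t =>
    if h : t ≤ m then f ∘ₗ (V.map (homOfLE h)).hom else 0 with hgdef
  have hgmap (s t : ℤ) (h : s ≤ t) (ht : t ≤ m) (v : V.obj s) :
      g t ((V.map (homOfLE h)).hom v) = g s v := by
    simp only [hgdef, ht, h.trans ht, dite_true, LinearMap.comp_apply]
    rw [map_map_apply]
  have hg (t : ℤ) (ht : ¬ t ≤ m) : g t = 0 := by simp [hgdef, ht]
  have hgx (t : ℤ) (ht : t ∈ J.support) : g t (x t) = 1 := by
    have ht2 : t ≤ m := ht.2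
    simp only [hgdef, ht2, dite_true, LinearMap.comp_apply]
    rw [hxmap t m ht2 ht.1, hf]
  set U' : ∀ t, Submodule F (V.obj t) := fun t => U t ⊓ LinearMap.ker (g t) with hU'def
  have hU'J (t : ℤ) (ht : t ∈ J.support) := finrank_inf_ker_add_one (U t) (g t) (hxU t) (hgx t ht)
  have hU'nJ (t : ℤ) (ht : t ∉ J.support) : U' t = U t := by
    by_cases h : l ≤ t
    · have hmt : ¬ t ≤ m := fun h' => ht ⟨h, h'⟩
      simp [hU'def, hg t hmt]
    · simp [hU'def, hlow t (not_le.1 h)]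
  have hrank (t : ℤ) : Module.finrank F (U t) =
      (if t ∈ J.support then 1 else 0) + Module.finrank F (U' t) := by
    split_ifs with ht
    · rw [← (hU'J t ht).1, add_comm]
    · rw [hU'nJ t ht, zero_add]
  have hlt : ∑ t ∈ Finset.Icc a b, Module.finrank F (U' t) < n := by
    rw [← hn]
    refine Finset.sum_lt_sum (fun t _ => by rw [hrank t]; lia) ⟨l, ?_, ?_⟩
    · rw [Finset.mem_Icc]
      by_contra h
      exact hl (hab l h)
    · rw [hrank l, if_pos J.fst_mem_support]
      lia
  obtain ⟨ι, _, J', x', h1, h2, h3⟩ := ih _ hlt U' (fun s t h v hv => by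
    refine ⟨hU s t h v hv.1, ?_⟩
    change g t _ = 0
    by_cases ht : t ≤ m
    · rw [hgmap s t h ht]
      exact hv.2
    · rw [hg t ht, LinearMap.zero_apply]) (fun t ht => by simp [hU'def, hab t ht]) rfl
  refine ⟨Option ι, inferInstance, fun i => i.elim J J', fun i => i.elim x x', ?_, fun t => ?_,
    fun t => ?_⟩
  · rintro (_ | i)
    · exact hxJ
    · exact h1 i
  · have : (Set.range fun i : Option ι => (i.elim x x' : ∀ t, V.obj t) t) =
        insert (x t) (Set.range fun i => x' i t) := by
      ext v
      simp only [Set.mem_range, Option.exists, Option.elim, Set.mem_insert_iff, eq_comm]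
    rw [this, Submodule.span_insert, h2, sup_comm]
    by_cases ht : t ∈ J.support
    · exact (hU'J t ht).2
    · rw [hU'nJ t ht, hxJ.1 t ht]
      simp
  · rw [hrank t, ← h3, Fintype.sum_option]
    rfl

theorem IsPersistenceModule.exists_isBarcode {V : ℤ ⥤ ModuleCat.{u} F}
    (hV : IsPersistenceModule V) : ∃ B, IsBarcode V B := by
  classical
  obtain ⟨a, b, hab⟩ := hV.bounded
  obtain ⟨ι, _, J, x, h1, h2, h3⟩ := exists_sectionsOn_span_eq V hV.finite a b _ (fun _ => ⊤)
    (fun _ _ _ _ _ => trivial) (fun t ht => by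
      have := hab t ht
      exact Subsingleton.elim _ _) rfl
  refine ⟨_, isBarcode_iff.2 ⟨ι, _, J, x, rfl, h1, fun t => (h2 t).ge, fun t => ?_⟩⟩
  rw [← finrank_top, ← h3 t, Nat.card_eq_fintype_card, Fintype.card_subtype, Finset.card_filter]

theorem IsPersistenceModule.isBarcode_barcode {V : ℤ ⥤ ModuleCat.{u} F}
    (hV : IsPersistenceModule V) : IsBarcode V (barcode V) :=
  Classical.epsilon_spec hV.exists_isBarcode

/-! ### Existence of ladder decompositions -/

/-- Index `none` pads the family with zero sections, as needed for the missing side of unmatched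
bars. -/
theorem IsIntervalBasis.reindex {ι ι' : Type} [Fintype ι] [Fintype ι'] {V : ℤ ⥤ ModuleCat.{u} F}
    {S : ι → Set ℤ} {x : ι → ∀ t, V.obj t} (h : IsIntervalBasis V S x) (f : ι' → Option ι)
    (hf : ∀ i, ∃! p, f p = some i) :
    IsIntervalBasis V (fun p => (f p).elim ∅ S) fun p => (f p).elim 0 x where
  mem p := by
    rcases f p with _ | i
    · exact zero_mem _
    · exact h.mem i
  span t := (h.span t).trans (Submodule.span_le.2 (by
    rintro _ ⟨i, rfl⟩
    obtain ⟨p, hp, -⟩ := hf i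
    refine Submodule.subset_span ⟨p, ?_⟩
    simp [hp]))
  card t := by
    rw [← h.card t]
    have hex (p : {p // t ∈ (f p).elim ∅ S}) : ∃ i : {i // t ∈ S i}, f p = some i.1 := by
      obtain ⟨p, hp⟩ := p
      rcases hfp : f p with _ | i
      · simp [hfp] at hp
      · exact ⟨⟨i, by simpa [hfp] using hp⟩, rfl⟩
    choose g hg using hex
    refine Nat.card_eq_of_bijective g ⟨fun p q hpq => ?_, fun i => ?_⟩
    · exact Subtype.ext ((hf (g p)).unique (hg p) (hpq ▸ hg q))
    · obtain ⟨p, hp, -⟩ := hf i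
      refine ⟨⟨p, by simpa [hp] using i.2⟩, Subtype.ext ?_⟩
      exact Option.some_injective _ ((hg _).symm.trans hp)

open Classical in
/-- The restriction of a family of vectors to the indices in a bar. -/
noncomputable def truncate {V : ℤ ⥤ ModuleCat.{u} F} (J : Bar) (z : ∀ t, V.obj t) :
    ∀ t, V.obj t :=
  fun t => if t ∈ J.support then z t else 0

theorem truncate_of_mem {V : ℤ ⥤ ModuleCat.{u} F} {J : Bar} {t : ℤ} (ht : t ∈ J.support)
    (z : ∀ t, V.obj t) : truncate J z t = z t := if_pos ht

theorem truncate_of_notMem {V : ℤ ⥤ ModuleCat.{u} F} {J : Bar} {t : ℤ} (ht : t ∉ J.support)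
    (z : ∀ t, V.obj t) : truncate J z t = 0 := if_neg ht

/-- If J' ≤ J at both ends, truncation is precomposition with k_J ⟶ k_{J'}, or zero when the bars
are disjoint. These are the admissible row and column operations. -/
theorem truncate_mem_sectionsOn {V : ℤ ⥤ ModuleCat.{u} F} {J J' : Bar} {z : ∀ t, V.obj t}
    (hz : z ∈ sectionsOn V J'.support) (h₁ : J'.fst ≤ J.fst) (h₂ : J'.snd ≤ J.snd) :
    truncate J z ∈ sectionsOn V J.support := by
  refine ⟨fun t ht => truncate_of_notMem ht z, fun s t h hs => ?_⟩
  rw [truncate_of_mem hs]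
  rw [Bar.mem_support] at hs
  by_cases hs' : s ∈ J'.support
  · rw [hz.2 s t h hs']
    by_cases ht : t ∈ J.support
    · rw [truncate_of_mem ht]
    · rw [truncate_of_notMem ht]
      refine hz.1 t fun h' => ht ?_
      rw [Bar.mem_support] at h' ⊢
      lia
  · rw [hz.1 s hs', map_zero]
    by_cases ht : t ∈ J.support
    · rw [truncate_of_mem ht, hz.1 t]
      rw [Bar.mem_support] at hs' ⊢
      lia
    · rw [truncate_of_notMem ht]

/-! ### The matrix of a morphism in interval bases -/

section Entry

variable {V W : ℤ ⥤ ModuleCat.{u} F} {κ : Type} [Fintype κ] {K : κ → Bar} {y : κ → ∀ t, W.obj t}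

/-- The coefficients of the image under `Φ` of a section over the bar `J`. -/
noncomputable def entry (hy : IsIntervalBasis W (fun k => (K k).support) y) (Φ : V ⟶ W) (J : Bar)
    (z : ∀ t, V.obj t) (k : κ) : F :=
  hy.coord k J.fst ((Φ.app J.fst).hom (z J.fst))

variable {hy : IsIntervalBasis W (fun k => (K k).support) y} {Φ : V ⟶ W} {J : Bar}
  {z : ∀ t, V.obj t}

/-- There are no nonzero morphisms k_J ⟶ k_K otherwise: if K outlived J, the entry would survive to
`J.snd + 1`, where z is already 0. -/
theorem overlaps_of_entry_ne_zero (hz : z ∈ sectionsOn V J.support) {k : κ}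
    (hk : entry hy Φ J z k ≠ 0) : (K k).Overlaps J := by
  have h1 := hy.mem_of_coord_ne_zero hk
  refine ⟨h1.1, h1.2, ?_⟩
  by_contra hlt
  have h2 : J.fst ≤ J.snd + 1 := by have := J.fst_le_snd; lia
  have h3 : J.snd + 1 ∈ (K k).support := by
    rw [Bar.mem_support] at h1 ⊢
    lia
  refine hk ?_
  rw [entry, ← hy.coord_map h2 h3, ← naturality_apply, hz.2 _ _ h2 J.fst_mem_support, hz.1,
    map_zero, map_zero]
  rw [Bar.mem_support]
  lia

theorem app_eq_sum_entry (hz : z ∈ sectionsOn V J.support) {t : ℤ} (ht : J.fst ≤ t) :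
    (Φ.app t).hom (z t) = ∑ k, entry hy Φ J z k • y k t := by
  rw [← hz.2 _ _ ht J.fst_mem_support, naturality_apply,
    ← hy.sum_coord J.fst ((Φ.app J.fst).hom (z J.fst)), map_sum]
  refine Finset.sum_congr rfl fun k _ => ?_
  rw [map_smul]
  change entry hy Φ J z k • _ = _
  by_cases hk : entry hy Φ J z k = 0
  · rw [hk, zero_smul, zero_smul]
  · rw [hy.map_apply ht (hy.mem_of_coord_ne_zero hk)]

-- Coefficients on bars not containing `J.fst` are invisible, since the corresponding y k vanish
-- there.
open Classical in
theorem entry_eq_of_app_eq_sum {B : κ → F}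
    (hB : (Φ.app J.fst).hom (z J.fst) = ∑ k, B k • y k J.fst) (k : κ) :
    entry hy Φ J z k = if J.fst ∈ (K k).support then B k else 0 := by
  rw [entry, hB]
  split_ifs with h
  · exact hy.coord_sum h B
  · exact hy.coord_eq_zero h _

end Entry

/-! ### Gaussian elimination with comparable bars -/

section Elimination

variable {V W : ℤ ⥤ ModuleCat.{u} F} {ι κ : Type} [Fintype ι] [Fintype κ] {J : ι → Bar}
  {K : κ → Bar} {x : ι → ∀ t, V.obj t} {y : κ → ∀ t, W.obj t}

/-- The column `j` of the matrix of `Φ` has a single nonzero entry, which is `1` and the only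
nonzero entry in its row. -/
def IsReducedColumn (hy : IsIntervalBasis W (fun k => (K k).support) y) (Φ : V ⟶ W) (J : ι → Bar)
    (x : ι → ∀ t, V.obj t) (j : ι) : Prop :=
  ∃ k, entry hy Φ (J j) (x j) k = 1 ∧ (∀ k' ≠ k, entry hy Φ (J j) (x j) k' = 0) ∧
    ∀ j' ≠ j, entry hy Φ (J j') (x j') k = 0

/-- One pivot step. `hcol` allows y k₀ to be replaced by Φ(x j₀) restricted to K k₀, which clears
the column; `hrow` allows multiples of x j₀ to be subtracted from the other x j, which clears the
row. -/
theorem exists_isReducedColumn (hx : IsIntervalBasis V (fun j => (J j).support) x)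
    (hy : IsIntervalBasis W (fun k => (K k).support) y) (Φ : V ⟶ W) {j₀ : ι} {k₀ : κ}
    (h₀ : entry hy Φ (J j₀) (x j₀) k₀ ≠ 0)
    (hcol : ∀ k, entry hy Φ (J j₀) (x j₀) k ≠ 0 → (K k).fst ≤ (K k₀).fst ∧ (K k).snd ≤ (K k₀).snd)
    (hrow : ∀ j, entry hy Φ (J j) (x j) k₀ ≠ 0 → (J j₀).fst ≤ (J j).fst ∧ (J j₀).snd ≤ (J j).snd) :
    ∃ (x' : ι → ∀ t, V.obj t) (y' : κ → ∀ t, W.obj t)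
      (_ : IsIntervalBasis V (fun j => (J j).support) x')
      (hy' : IsIntervalBasis W (fun k => (K k).support) y'),
      IsReducedColumn hy' Φ J x' j₀ ∧
        ∀ j, IsReducedColumn hy Φ J x j → IsReducedColumn hy' Φ J x' j := by
  classical
  set A : κ → ι → F := fun k j => entry hy Φ (J j) (x j) k with hA
  have hA0 (k : κ) (j : ι) (h : A k j ≠ 0) : (K k).Overlaps (J j) :=
    overlaps_of_entry_ne_zero (hx.mem j) h
  set c : ι → F := fun j => if j = j₀ then 0 else A k₀ j / A k₀ j₀ with hc
  have hcne (j : ι) (hj : c j ≠ 0) : (J j₀).fst ≤ (J j).fst ∧ (J j₀).snd ≤ (J j).snd := by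
    refine hrow j fun h => hj ?_
    change A k₀ j = 0 at h
    simp [hc, h]
  have hc0 : c j₀ = 0 := by simp [hc]
  set x' : ι → ∀ t, V.obj t := fun j => x j - c j • truncate (J j) (x j₀) with hx'def
  set w : ∀ t, W.obj t := ∑ k, A k j₀ • truncate (K k₀) (y k) with hwdef
  set y' : κ → ∀ t, W.obj t := Function.update y k₀ w with hy'def
  have hx'₀ : x' j₀ = x j₀ := by simp [hx'def, hc0]
  have hw (t : ℤ) (ht : t ∈ (K k₀).support) : w t = ∑ k, A k j₀ • y k t := by
    rw [hwdef, Finset.sum_apply]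
    refine Finset.sum_congr rfl fun k _ => ?_
    rw [Pi.smul_apply, truncate_of_mem ht]
  have hy'₀ : y' k₀ = w := by simp [hy'def]
  have hy'ne (k : κ) (hk : k ≠ k₀) : y' k = y k := by simp [hy'def, hk]
  have hx' : IsIntervalBasis V (fun j => (J j).support) x' := by
    refine hx.of_mem_span (fun j => ?_) fun j t => ?_
    · refine sub_mem (hx.mem j) ?_
      by_cases hj : c j = 0
      · rw [hj, zero_smul]
        exact zero_mem _
      · exact Submodule.smul_mem _ _
          (truncate_mem_sectionsOn (hx.mem j₀) (hcne j hj).1 (hcne j hj).2)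
    · by_cases ht : t ∈ (J j).support
      · have : x j t = x' j t + c j • x' j₀ t := by
          rw [hx'₀]
          simp [hx'def, truncate_of_mem ht]
        rw [this]
        exact add_mem (Submodule.subset_span ⟨j, rfl⟩)
          (Submodule.smul_mem _ _ (Submodule.subset_span ⟨j₀, rfl⟩))
      · rw [hx.apply_eq_zero ht]
        exact zero_mem _
  have hy' : IsIntervalBasis W (fun k => (K k).support) y' := by
    refine hy.of_mem_span (fun k => ?_) fun k t => ?_
    · by_cases hk : k = k₀
      · subst hk
        rw [hy'₀]
        refine Submodule.sum_mem _ fun k' _ => ?_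
        by_cases hk' : A k' j₀ = 0
        · rw [hk', zero_smul]
          exact zero_mem _
        · exact Submodule.smul_mem _ _
            (truncate_mem_sectionsOn (hy.mem k') (hcol k' hk').1 (hcol k' hk').2)
      · rw [hy'ne k hk]
        exact hy.mem k
    · by_cases hk : k = k₀
      · subst hk
        by_cases ht : t ∈ (K k).support
        · have h1 : w t = A k j₀ • y k t + ∑ k' ∈ Finset.univ.erase k, A k' j₀ • y k' t := by
            rw [hw t ht, Finset.add_sum_erase _ (fun k' => A k' j₀ • y k' t) (Finset.mem_univ k)]
          have h2 : y k t = (A k j₀)⁻¹ •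
              (y' k t - ∑ k' ∈ Finset.univ.erase k, A k' j₀ • y' k' t) := by
            have h3 : ∑ k' ∈ Finset.univ.erase k, A k' j₀ • y' k' t =
                ∑ k' ∈ Finset.univ.erase k, A k' j₀ • y k' t :=
              Finset.sum_congr rfl fun k' hk' => by rw [hy'ne k' (Finset.ne_of_mem_erase hk')]
            rw [h3, hy'₀, h1, add_sub_cancel_right, smul_smul, inv_mul_cancel₀ h₀, one_smul]
          rw [h2]
          exact Submodule.smul_mem _ _ (sub_mem (Submodule.subset_span ⟨k, rfl⟩)
            (Submodule.sum_mem _ fun k' _ => Submodule.smul_mem _ _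
              (Submodule.subset_span ⟨k', rfl⟩)))
        · rw [hy.apply_eq_zero ht]
          exact zero_mem _
      · rw [← hy'ne k hk]
        exact Submodule.subset_span ⟨k, rfl⟩
  have hE₀ (k : κ) : entry hy' Φ (J j₀) (x' j₀) k = if k = k₀ then 1 else 0 := by
    have hov := hA0 k₀ j₀ h₀
    have hmem : (J j₀).fst ∈ (K k₀).support := ⟨hov.1, hov.2.1⟩
    rw [entry_eq_of_app_eq_sum (B := fun k => if k = k₀ then 1 else 0)]
    · by_cases hk : k = k₀
      · subst hk
        simp [hmem]
      · simp [hk]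
    · rw [hx'₀, app_eq_sum_entry (hy := hy) (hx.mem j₀) le_rfl]
      simp [hy'₀, hw _ hmem, hA]
  have hE (j : ι) (hj : j ≠ j₀) (k : κ) : entry hy' Φ (J j) (x' j) k =
      if (J j).fst ∈ (K k).support then A k j - c j * A k j₀ else 0 := by
    refine entry_eq_of_app_eq_sum (B := fun k => A k j - c j * A k j₀) ?_ k
    have h1 : (Φ.app (J j).fst).hom (x' j (J j).fst) =
        ∑ k, (A k j - c j * A k j₀) • y k (J j).fst := by
      have h2 : x' j (J j).fst = x j (J j).fst - c j • x j₀ (J j).fst := by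
        simp [hx'def, truncate_of_mem (J j).fst_mem_support]
      simp_rw [sub_smul, mul_smul, Finset.sum_sub_distrib, ← Finset.smul_sum]
      rw [h2, map_sub, map_smul, app_eq_sum_entry (hy := hy) (hx.mem j) le_rfl]
      by_cases hcj : c j = 0
      · simp [hcj, hA]
      · rw [app_eq_sum_entry (hy := hy) (hx.mem j₀) (hcne j hcj).1]
    rw [h1]
    refine Finset.sum_congr rfl fun k _ => ?_
    by_cases hk : k = k₀
    · subst hk
      have : A k j - c j * A k j₀ = 0 := by
        simp only [hc, hj, if_false]
        rw [div_mul_cancel₀ _ h₀, sub_self]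
      rw [this, zero_smul, zero_smul]
    · rw [hy'ne k hk]
  have hred₀ : IsReducedColumn hy' Φ J x' j₀ := by
    refine ⟨k₀, by rw [hE₀, if_pos rfl], fun k hk => by rw [hE₀, if_neg hk], fun j hj => ?_⟩
    rw [hE j hj]
    simp only [hc, hj, if_false]
    rw [div_mul_cancel₀ _ h₀, sub_self, ite_self]
  refine ⟨x', y', hx', hy', hred₀, fun j hj => ?_⟩
  by_cases hjj : j = j₀
  · rw [hjj]
    exact hred₀
  obtain ⟨k, h1, h2, h3⟩ := hj
  -- A column already reduced at row k meets neither the pivot row nor, through its own row, the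
  -- pivot column, so the step leaves its pattern intact.
  have hkk : k ≠ k₀ := by
    rintro rfl
    exact h₀ (h3 j₀ (Ne.symm hjj))
  have hk₀j : A k₀ j = 0 := h2 k₀ (Ne.symm hkk)
  have hcj : c j = 0 := by simp [hc, hk₀j]
  refine ⟨k, ?_, fun k' hk' => ?_, fun j' hj' => ?_⟩
  · have hov := hA0 k j (by change A k j = 1 at h1; rw [h1]; exact one_ne_zero)
    rw [hE j hjj, if_pos ⟨hov.1, hov.2.1⟩, hcj, zero_mul, sub_zero]
    exact h1
  · rw [hE j hjj, hcj, zero_mul, sub_zero, show A k' j = 0 from h2 k' hk', ite_self]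
  · by_cases hj₀ : j' = j₀
    · rw [hj₀, hE₀, if_neg hkk]
    · rw [hE j' hj₀, show A k j' = 0 from h3 j' hj', show A k j₀ = 0 from h3 j₀ (Ne.symm hjj),
        mul_zero, sub_zero, ite_self]

theorem exists_isLadderDecomposition_of_reduced
    (hx : IsIntervalBasis V (fun j => (J j).support) x)
    (hy : IsIntervalBasis W (fun k => (K k).support) y) (Φ : V ⟶ W)
    (hred : ∀ j, (∃ k, entry hy Φ (J j) (x j) k ≠ 0) → IsReducedColumn hy Φ J x j) :
    ∃ L, IsLadderDecomposition Φ L := by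
  classical
  set A : κ → ι → F := fun k j => entry hy Φ (J j) (x j) k with hA
  have hcol (k k' : κ) (j : ι) (h : A k j ≠ 0) (h' : A k' j ≠ 0) : k = k' := by
    obtain ⟨l, -, h2, -⟩ := hred j ⟨k, h⟩
    have h3 : k = l := by_contra fun hne => h (h2 k hne)
    have h4 : k' = l := by_contra fun hne => h' (h2 k' hne)
    rw [h3, h4]
  have hone (k : κ) (j : ι) (h : A k j ≠ 0) : A k j = 1 := by
    obtain ⟨l, h1, h2, -⟩ := hred j ⟨k, h⟩
    have h3 : k = l := by_contra fun hne => h (h2 k hne)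
    rw [h3]
    exact h1
  have hrow (k : κ) (j j' : ι) (h : A k j ≠ 0) (h' : A k j' ≠ 0) : j = j' := by
    obtain ⟨l, -, h2, h5⟩ := hred j ⟨k, h⟩
    have h3 : k = l := by_contra fun hne => h (h2 k hne)
    by_contra hne
    subst h3
    exact h' (h5 j' (Ne.symm hne))
  -- A reduced matrix is a partial permutation matrix. Its entries give the summands `R`, its zero
  -- columns `I⁺`, its zero rows `I⁻`.
  let Q : Option ι → Option κ → Prop := fun p q => match p, q with
    | some j, some k => A k j ≠ 0
    | some j, none => ∀ k, A k j = 0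
    | none, some k => ∀ j, A k j = 0
    | none, none => False
  let ι' := {p : Option ι × Option κ // Q p.1 p.2}
  have hE (p : ι') : ∃ E : ElementaryLadder,
      E.srcSupport = p.1.1.elim ∅ (fun j => (J j).support) ∧
        E.tgtSupport = p.1.2.elim ∅ (fun k => (K k).support) := by
    obtain ⟨⟨_ | j, _ | k⟩, h⟩ := p
    · exact h.elim
    · exact ⟨.Iminus (K k), rfl, rfl⟩
    · exact ⟨.Iplus (J j), rfl, rfl⟩
    · exact ⟨.R (J j) (K k) (overlaps_of_entry_ne_zero (hx.mem j) h), rfl, rfl⟩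
  choose E hE₁ hE₂ using hE
  refine ⟨_, isLadderDecomposition_iff.2 ⟨ι', inferInstance, E, fun p => p.1.1.elim 0 x,
    fun p => p.1.2.elim 0 y, rfl, ?_, ?_, ?_⟩⟩
  · refine (hx.reindex (fun p : ι' => p.1.1) fun j => ?_).congr_supports fun p => (hE₁ p).symm
    by_cases hj : ∃ k, A k j ≠ 0
    · obtain ⟨k, hk⟩ := hj
      refine ⟨⟨(some j, some k), hk⟩, rfl, ?_⟩
      rintro ⟨⟨_ | j', _ | k'⟩, h⟩ hp
      · exact h.elim
      · simp at hp
      · obtain rfl := Option.some_injective _ hp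
        exact absurd (h k) hk
      · obtain rfl := Option.some_injective _ hp
        obtain rfl := hcol k k' j' hk h
        rfl
    · push Not at hj
      refine ⟨⟨(some j, none), hj⟩, rfl, ?_⟩
      rintro ⟨⟨_ | j', _ | k'⟩, h⟩ hp
      · exact h.elim
      · simp at hp
      · obtain rfl := Option.some_injective _ hp
        rfl
      · obtain rfl := Option.some_injective _ hp
        exact absurd (hj k') h
  · refine (hy.reindex (fun p : ι' => p.1.2) fun k => ?_).congr_supports fun p => (hE₂ p).symm
    by_cases hk : ∃ j, A k j ≠ 0
    · obtain ⟨j, hj⟩ := hk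
      refine ⟨⟨(some j, some k), hj⟩, rfl, ?_⟩
      rintro ⟨⟨_ | j', _ | k'⟩, h⟩ hp
      · exact h.elim
      · obtain rfl := Option.some_injective _ hp
        exact absurd (h j) hj
      · simp at hp
      · obtain rfl := Option.some_injective _ hp
        obtain rfl := hrow k' j j' hj h
        rfl
    · push Not at hk
      refine ⟨⟨(none, some k), hk⟩, rfl, ?_⟩
      rintro ⟨⟨_ | j', _ | k'⟩, h⟩ hp
      · exact h.elim
      · obtain rfl := Option.some_injective _ hp
        rfl
      · simp at hp
      · obtain rfl := Option.some_injective _ hp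
        exact absurd (hk j') h
  · intro p t ht
    rw [hE₁] at ht
    obtain ⟨⟨_ | j, _ | k⟩, h⟩ := p
    · exact h.elim
    · simp at ht
    · change (Φ.app t).hom (x j t) = 0
      rw [app_eq_sum_entry (hy := hy) (hx.mem j) ht.1]
      exact Finset.sum_eq_zero fun k _ => by
        rw [show entry hy Φ (J j) (x j) k = 0 from h k, zero_smul]
    · change (Φ.app t).hom (x j t) = y k t
      rw [app_eq_sum_entry (hy := hy) (hx.mem j) ht.1, Finset.sum_eq_single k]
      · rw [show entry hy Φ (J j) (x j) k = 1 from hone k j h, one_smul]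
      · intro k' _ hk'
        rw [show entry hy Φ (J j) (x j) k' = 0 from by_contra fun h' => hk' (hcol k' k j h' h),
          zero_smul]
      · simp

end Elimination

/-! ### Choice of pivots under the nestedness bound -/

section Interleaving

variable {V W : ℤ ⥤ ModuleCat.{u} F} {ι κ : Type} [Fintype ι] [Fintype κ] {J : ι → Bar}
  {K : κ → Bar} {x : ι → ∀ t, V.obj t} {y : κ → ∀ t, W.obj t}

/-- The coefficient of x j in ΨΦ(x j) is 1 because J j has length at least d. Hence some k has
nonzero coefficients both from j and back to j, and the latter is a morphism into the bar J j
shifted by d, which bounds the ends of K k from below. -/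
theorem exists_entry_ne_zero (hx : IsIntervalBasis V (fun j => (J j).support) x)
    (hy : IsIntervalBasis W (fun k => (K k).support) y) {d : ℤ} (hd : 0 ≤ d) (Φ : V ⟶ W)
    (Ψ : W ⟶ shift d V) (hΨΦ : ∀ t v, (Ψ.app t).hom ((Φ.app t).hom v) =
      (V.map (homOfLE (by lia : t ≤ t + d))).hom v)
    {j : ι} (hj : (J j).fst + d ≤ (J j).snd) :
    ∃ k, entry hy Φ (J j) (x j) k ≠ 0 ∧ (J j).fst - d ≤ (K k).fst ∧
      (J j).snd - d ≤ (K k).snd := by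
  classical
  have hxs := hx.shift d
  have hmem : (J j).fst + d ∈ (J j).support := by
    rw [Bar.mem_support]
    lia
  have h1 : hxs.coord j (J j).fst ((Ψ.app _).hom ((Φ.app _).hom (x j (J j).fst))) = 1 := by
    rw [hΨΦ, hx.map_apply _ (J j).fst_mem_support]
    exact (hxs.coord_apply j j (J j).fst).trans (if_pos ⟨hmem, rfl⟩)
  rw [app_eq_sum_entry (hy := hy) (hx.mem j) le_rfl, map_sum, map_sum] at h1
  obtain ⟨k, -, hk⟩ := Finset.exists_ne_zero_of_sum_ne_zero (h1.trans_ne one_ne_zero)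
  rw [map_smul, map_smul, smul_eq_mul] at hk
  have hk1 := left_ne_zero_of_mul hk
  have hk2 := right_ne_zero_of_mul hk
  have hov := overlaps_of_entry_ne_zero (hx.mem j) hk1
  refine ⟨k, hk1, ?_, ?_⟩
  · by_contra hlt
    have hmem' : (J j).fst ∈ (K k).support := ⟨hov.1, hov.2.1⟩
    rw [← hy.map_apply hov.1 (K k).fst_mem_support, naturality_apply,
      hxs.coord_map hov.1 hmem] at hk2
    have h2 := (Bar.mem_support.1 (hxs.mem_of_coord_ne_zero hk2)).1
    lia
  · by_contra hlt
    have hov2 := hov.2.1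
    have hle : (J j).fst ≤ (K k).snd + 1 := by lia
    have hmem' : (K k).snd + 1 + d ∈ (J j).support := by
      rw [Bar.mem_support]
      lia
    have hmem'' : (J j).fst ∈ (K k).support := ⟨hov.1, hov.2.1⟩
    refine hk2 ?_
    rw [← hxs.coord_map hle hmem', ← naturality_apply, hy.map_apply hle hmem'',
      hy.apply_eq_zero, map_zero, map_zero]
    rw [Bar.mem_support]
    lia

theorem exists_isLadderDecomposition (hx : IsIntervalBasis V (fun j => (J j).support) x)
    (hy : IsIntervalBasis W (fun k => (K k).support) y) {d : ℤ} (hd : 0 ≤ d) (Φ : V ⟶ W)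
    (Ψ : W ⟶ shift d V) (hΨΦ : ∀ t v, (Ψ.app t).hom ((Φ.app t).hom v) =
      (V.map (homOfLE (by lia : t ≤ t + d))).hom v)
    (hV : ∀ j j', (J j).StrictlyNested (J j') →
      d < (J j).fst - (J j').fst ∧ d < (J j').snd - (J j).snd)
    (hW : ∀ k k', (K k).StrictlyNested (K k') →
      d < (K k).fst - (K k').fst ∧ d < (K k').snd - (K k).snd) :
    ∃ L, IsLadderDecomposition Φ L := by
  classical
  generalize hn : (Finset.univ.filter fun j => ¬ IsReducedColumn hy Φ J x j).card = n
  induction n using Nat.strong_induction_on generalizing x y with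
  | _ n ih =>
  by_cases hred : ∀ j, (∃ k, entry hy Φ (J j) (x j) k ≠ 0) → IsReducedColumn hy Φ J x j
  · exact exists_isLadderDecomposition_of_reduced hx hy Φ hred
  push Not at hred
  obtain ⟨j₁, ⟨k₁, hk₁⟩, hj₁⟩ := hred
  -- Right ends are compared before left ends for target bars, and left ends before right ends for
  -- source bars. A lexicographic extremum can then fail to be comparable only through strict
  -- nesting.
  obtain ⟨k₀, hk₀, hmax⟩ := Finset.exists_max_image
    (Finset.univ.filter fun k => ∃ j, ¬ IsReducedColumn hy Φ J x j ∧ entry hy Φ (J j) (x j) k ≠ 0)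
    (fun k => toLex ((K k).snd, (K k).fst)) ⟨k₁, by simpa using ⟨j₁, hj₁, hk₁⟩⟩
  simp only [Finset.mem_filter, Finset.mem_univ, true_and] at hk₀ hmax
  obtain ⟨j₂, hj₂, hk₀j₂⟩ := hk₀
  obtain ⟨j₀, hj₀, hmin⟩ := Finset.exists_min_image
    (Finset.univ.filter fun j => entry hy Φ (J j) (x j) k₀ ≠ 0)
    (fun j => toLex ((J j).fst, (J j).snd)) ⟨j₂, by simpa using hk₀j₂⟩
  simp only [Finset.mem_filter, Finset.mem_univ, true_and] at hj₀ hmin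
  -- A reduced column through row k₀ would be the only one there, forcing j₂ to be reduced. Thus
  -- maximality of k₀ applies to every column of its row.
  have hnred (j : ι) (hj : entry hy Φ (J j) (x j) k₀ ≠ 0) : ¬ IsReducedColumn hy Φ J x j := by
    intro hred
    obtain ⟨k, -, h2, h3⟩ := id hred
    obtain rfl : k₀ = k := by_contra fun hne => hj (h2 k₀ hne)
    exact hk₀j₂ (h3 j₂ fun h => hj₂ (h ▸ hred))
  have hov (k : κ) (j : ι) (h : entry hy Φ (J j) (x j) k ≠ 0) :=
    overlaps_of_entry_ne_zero (hx.mem j) h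
  have hlex (k : κ) (j : ι) (hj : entry hy Φ (J j) (x j) k₀ ≠ 0)
      (h : entry hy Φ (J j) (x j) k ≠ 0) :
      (K k).snd < (K k₀).snd ∨ (K k).snd = (K k₀).snd ∧ (K k).fst ≤ (K k₀).fst :=
    Prod.Lex.toLex_le_toLex.1 (hmax k ⟨j, hnred j hj, h⟩)
  obtain ⟨x', y', hx', hy', hred₀, hred⟩ := exists_isReducedColumn hx hy Φ hj₀ (fun k hk => by
    have hlt := hlex k j₀ hj₀ hk
    by_contra hcon
    -- K k is nested in K k₀ with margins above d, so J j₀ is long. The bar k' then starts after K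
    -- k₀ does; by maximality it must end strictly earlier, hence is nested, yet it ends within d of
    -- K k₀.
    have hnest := hW k k₀ ⟨by lia, by lia⟩
    obtain ⟨a1, a2, a3⟩ := hov k j₀ hk
    obtain ⟨b1, b2, b3⟩ := hov k₀ j₀ hj₀
    obtain ⟨k', hk', c1, c2⟩ := exists_entry_ne_zero hx hy hd Φ Ψ hΨΦ (j := j₀) (by lia)
    have hlt' := hlex k' j₀ hj₀ hk'
    by_cases hs : (K k').snd < (K k₀).snd
    · have := hW k' k₀ ⟨by lia, hs⟩
      lia
    · lia) (fun j hj => by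
    have hlt : (J j₀).fst < (J j).fst ∨ (J j₀).fst = (J j).fst ∧ (J j₀).snd ≤ (J j).snd :=
      Prod.Lex.toLex_le_toLex.1 (hmin j hj)
    by_contra hcon
    -- Now J j is nested in J j₀ with margins above d, and k' ends no earlier than d before J j₀
    -- does: after J j, hence after K k₀, against maximality.
    have hnest := hV j j₀ ⟨by lia, by lia⟩
    obtain ⟨a1, a2, a3⟩ := hov k₀ j hj
    obtain ⟨b1, b2, b3⟩ := hov k₀ j₀ hj₀
    obtain ⟨k', hk', c1, c2⟩ := exists_entry_ne_zero hx hy hd Φ Ψ hΨΦ (j := j₀) (by lia)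
    have hlt' := hlex k' j₀ hj₀ hk'
    lia)
  refine ih _ ?_ hx' hy' rfl
  rw [← hn]
  refine Finset.card_lt_card (Finset.ssubset_iff_subset_ne.2 ⟨fun j hj => ?_, fun heq => ?_⟩)
  · simp only [Finset.mem_filter, Finset.mem_univ, true_and] at hj ⊢
    exact fun h => hj (hred j h)
  · have : j₀ ∈ Finset.univ.filter fun j => ¬ IsReducedColumn hy Φ J x j := by
      simpa using hnred j₀ hj₀
    rw [← heq] at this
    simp only [Finset.mem_filter, Finset.mem_univ, true_and] at this
    exact this hred₀

end Interleaving

/-! ### Comparison of the two ladder decompositions of an interleaving -/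

theorem Bar.mem_support_shift {J : Bar} {d t : ℤ} :
    t ∈ (J.shift d).support ↔ t + d ∈ J.support := by
  simp only [Bar.mem_support, Bar.shift]
  lia

theorem Bar.support_shift (J : Bar) (d : ℤ) : {t | t + d ∈ J.support} = (J.shift d).support := by
  ext t
  exact Bar.mem_support_shift.symm

namespace IsLadderBasis

variable {ι : Type} [Fintype ι] {V W : ℤ ⥤ ModuleCat.{u} F}
    {Φ : V ⟶ W} {E : ι → ElementaryLadder} {x : ι → ∀ t, V.obj t} {y : ι → ∀ t, W.obj t}
    {d : ℤ} {Ψ : W ⟶ Ladder.shift d V} {J K : Bar} {hKJ : K.Overlaps J}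

-- Pushing y m from `K.fst` to `J.fst` turns it into Φ(x m), whose image under Ψ is x m at `J.fst +
-- d`; bars alive there retain their coefficients.
open Classical in
theorem coord_app_right (h : IsLadderBasis Φ E x y) (hd : 0 ≤ d)
    (hΨΦ : ∀ t v, (Ψ.app t).hom ((Φ.app t).hom v) = (V.map (homOfLE (by lia : t ≤ t + d))).hom v)
    {m : ι} (hm : E m = .R J K hKJ) {i : ι}
    (hi : J.fst + d ∈ (E i).srcSupport) :
    (h.left.shift d).coord i K.fst ((Ψ.app K.fst).hom (y m K.fst)) = if i = m then 1 else 0 := by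
  have hsrc : (E m).srcSupport = J.support := by rw [hm]; rfl
  have htgt : (E m).tgtSupport = K.support := by rw [hm]; rfl
  rw [← (h.left.shift d).coord_map hKJ.1 hi, ← naturality_apply,
    h.right.map_apply hKJ.1 (by rw [htgt]; exact K.fst_mem_support),
    ← h.app_eq m J.fst (by rw [hsrc]; exact J.fst_mem_support), hΨΦ,
    h.left.map_apply _ (by rw [hsrc]; exact J.fst_mem_support)]
  refine ((h.left.shift d).coord_apply i m J.fst).trans ?_
  simp only [Set.mem_ofPred_eq, hi, true_and]

/-- The coefficient 1 of Ψ(y m) on its partner puts `K.fst` in J(d). If K ended before J(d), that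
coefficient would outlive y m. -/
theorem overlaps_shift (h : IsLadderBasis Φ E x y) (hd : 0 ≤ d)
    (hΨΦ : ∀ t v, (Ψ.app t).hom ((Φ.app t).hom v) = (V.map (homOfLE (by lia : t ≤ t + d))).hom v)
    (hJ : J.fst + d ≤ J.snd) {m : ι} (hm : E m = .R J K hKJ) : (J.shift d).Overlaps K := by
  have hsrc : (E m).srcSupport = J.support := by rw [hm]; rfl
  have htgt : (E m).tgtSupport = K.support := by rw [hm]; rfl
  have hone := h.coord_app_right hd hΨΦ hm (i := m) (by
    rw [hsrc, Bar.mem_support]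
    lia)
  rw [if_pos rfl] at hone
  have h1 := (h.left.shift d).mem_of_coord_ne_zero (hone.trans_ne one_ne_zero)
  rw [Set.mem_ofPred_eq, hsrc, Bar.mem_support] at h1
  obtain ⟨k1, k2, k3⟩ := hKJ
  refine ⟨by simp only [Bar.shift]; lia, by simp only [Bar.shift]; lia, ?_⟩
  by_contra hlt
  simp only [Bar.shift] at hlt
  have hle : K.fst ≤ K.snd + 1 := by have := K.fst_le_snd; lia
  have hmem : K.snd + 1 ∈ {t | t + d ∈ (E m).srcSupport} := by
    rw [Set.mem_ofPred_eq, hsrc, Bar.mem_support]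
    lia
  rw [← (h.left.shift d).coord_map hle hmem, ← naturality_apply,
    h.right.map_apply hle (by rw [htgt]; exact K.fst_mem_support), h.right.apply_eq_zero,
    map_zero, map_zero] at hone
  · exact zero_ne_one hone
  · rw [htgt, Bar.mem_support]
    lia

/-- The images under Ψ of the target vectors over K are tested against the `R K J(d)` of Ψ. If a
combination has none of these coordinates, applying Φ shows that its coefficients vanish, as ΦΨ is
inner and K is long. -/
theorem card_R_le_of_interleaving (h : IsLadderBasis Φ E x y) {κ : Type} [Fintype κ]
    {E' : κ → ElementaryLadder} {y' : κ → ∀ t, W.obj t} {x' : κ → ∀ t, (Ladder.shift d V).obj t}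
    (h' : IsLadderBasis Ψ E' y' x') (hd : 0 ≤ d)
    (hΨΦ : ∀ t v, (Ψ.app t).hom ((Φ.app t).hom v) = (V.map (homOfLE (by lia : t ≤ t + d))).hom v)
    (hΦΨ : ∀ t w, (Φ.app (t + d)).hom ((Ψ.app t).hom w) =
      (W.map (homOfLE (by lia : t ≤ t + d))).hom w)
    (hV : ∀ i i' J J', (E i).srcSupport = Bar.support J → (E i').srcSupport = Bar.support J' →
      J.StrictlyNested J' → d < J.fst - J'.fst ∧ d < J'.snd - J.snd)
    (hJ : J.fst + d ≤ J.snd) (hK : K.fst + d ≤ K.snd) (hJK : (J.shift d).Overlaps K) :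
    Nat.card {i // E i = .R J K hKJ} ≤ Nat.card {i // E' i = .R K (J.shift d) hJK} := by
  classical
  have hsrc (m : {i // E i = .R J K hKJ}) : (E m).srcSupport = J.support := by rw [m.2]; rfl
  have htgt (m : {i // E i = .R J K hKJ}) : (E m).tgtSupport = K.support := by rw [m.2]; rfl
  have htK := K.fst_mem_support
  have htJ : K.fst ∈ (J.shift d).support := ⟨hJK.1, hJK.2.1⟩
  have hxs := h.left.shift d
  -- Besides m itself, only bars J' ending before `J.fst + d` occur in Ψ(y m). Were such a J' to
  -- start after J, it would be nested in J and so start after `J.fst + d`, yet it contains `K.fst +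
  -- d`.
  have hwin (m : {i // E i = .R J K hKJ}) :
      (Ψ.app K.fst).hom (y m K.fst) ∈ windowLE (Ladder.shift d V) htJ := by
    rw [windowLE, hxs.mem_window_iff]
    intro i hi
    have hKi : K.fst + d ∈ (E i).srcSupport := hxs.mem_of_coord_ne_zero hi
    simp only [Bar.shift, Set.mem_ofPred_eq]
    by_cases hJi : J.fst + d ∈ (E i).srcSupport
    · rw [h.coord_app_right hd hΨΦ m.2 hJi] at hi
      obtain rfl : i = m := by
        by_contra hne
        exact hi (if_neg hne)
      rw [hsrc, Bar.mem_support, Bar.mem_support]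
      lia
    · rcases (E i).isBarSupport_srcSupport with h0 | ⟨J', hJ'⟩
      · rw [h0] at hKi
        exact absurd hKi (Set.notMem_empty _)
      have hnest := hV i m J' J hJ' (hsrc m)
      rw [hJ', Bar.mem_support] at hKi hJi ⊢
      rw [Bar.mem_support]
      have o1 := hKJ.1
      have o2 := hJK.1
      simp only [Bar.shift] at o2
      by_cases hlt : J.fst < J'.fst
      · have := hnest ⟨hlt, by lia⟩
        lia
      · lia
  refine h'.right.card_le_of_independent (t := K.fst)
    (fun m : {i // E i = .R J K hKJ} => (Ψ.app K.fst).hom (y m K.fst))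
    {i | E' i = .R K (J.shift d) hJK} fun c hc => funext fun m => ?_
  have hΨ : (Ψ.app K.fst).hom (∑ m, c m • y m K.fst) =
      ∑ m, c m • (Ψ.app K.fst).hom (y m K.fst) := by
    simp only [map_sum, map_smul]
  have hu : ∑ m, c m • y m K.fst ∈ windowLE W htK := Submodule.sum_mem _ fun m _ =>
    Submodule.smul_mem _ (c m) (h.right.apply_mem_windowLE htK (htgt m))
  have hΨu : ∑ m, c m • (Ψ.app K.fst).hom (y m K.fst) ∈ windowLE (Ladder.shift d V) htJ :=
    Submodule.sum_mem _ fun m _ => Submodule.smul_mem _ (c m) (hwin m)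
  rw [← hΨ] at hc hΨu
  obtain ⟨u₁, hu₁, hw⟩ := h'.exists_sub_mem_windowLT hJK htK htJ hu hΨu hc
  have htm : K.fst + d ∈ (E m).tgtSupport := by
    rw [htgt, Bar.mem_support]
    lia
  have h1 := hxs.coord_eq_zero_of_mem_windowLT htJ hw (i := m) (by
    rw [hsrc]
    exact Bar.support_shift J d)
  rw [← map_sub] at h1
  have h2 : h.right.coord m (K.fst + d)
      ((Φ.app (K.fst + d)).hom ((Ψ.app K.fst).hom (∑ m, c m • y m K.fst - u₁))) = 0 :=
    (h.coord_app htm _).trans h1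
  rw [hΦΨ, h.right.coord_map _ htm, map_sub,
    h.right.coord_eq_zero_of_mem_windowLT htK hu₁ (htgt m), sub_zero,
    h.right.coord_sum_subtype m.2 (by rw [htgt]; exact htK)] at h2
  exact h2

end IsLadderBasis

/-! ### Multiplicities -/

theorem count_filterMap {α β : Type} [DecidableEq β] (g : α → Option β) (s : Multiset α) (b : β) :
    (s.filterMap g).count b = s.countP fun a => g a = some b := by
  induction s using Multiset.induction_on with
  | empty => simp
  | cons a s ih =>
    rcases h : g a with _ | c
    · rw [Multiset.filterMap_cons_none a s h, ih, Multiset.countP_cons_of_neg _ (by simp [h])]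
    · rw [Multiset.filterMap_cons_some g a s h, Multiset.count_cons, ih, Multiset.countP_cons, h]
      simp [eq_comm]

theorem count_filterMap_map_univ {ι α β : Type} [Fintype ι] [DecidableEq β] (E : ι → α)
    (g : α → Option β) (b : β) :
    ((Finset.univ.val.map E).filterMap g).count b = Nat.card {i // g (E i) = some b} := by
  classical
  rw [Multiset.filterMap_map, count_filterMap, Multiset.countP_eq_card_filter,
    Nat.card_eq_fintype_card, Fintype.card_subtype]
  rfl

namespace ElementaryLadder

/-- The bar on the source side. -/
def src? : ElementaryLadder → Option Bar
  | R J _ _ => some J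
  | Iplus J => some J
  | Iminus _ => none

/-- The bar on the target side. -/
def tgt? : ElementaryLadder → Option Bar
  | R _ K _ => some K
  | Iplus _ => none
  | Iminus K => some K

theorem empty_ne_support (J : Bar) : ∅ ≠ J.support := fun h =>
  Set.notMem_empty _ (h ▸ J.fst_mem_support)

theorem src?_eq_some_iff {E : ElementaryLadder} {J : Bar} :
    E.src? = some J ↔ E.srcSupport = J.support := by
  cases E <;> simp [src?, srcSupport, Bar.support_injective.eq_iff, empty_ne_support]

theorem tgt?_eq_some_iff {E : ElementaryLadder} {J : Bar} :
    E.tgt? = some J ↔ E.tgtSupport = J.support := by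
  cases E <;> simp [tgt?, tgtSupport, Bar.support_injective.eq_iff, empty_ne_support]

theorem pair?_eq_some_iff {E : ElementaryLadder} {J K : Bar} (h : K.Overlaps J) :
    E.pair? = some (J, K) ↔ E = .R J K h := by
  cases E <;> simp [pair?]

theorem overlaps_of_pair?_eq_some {E : ElementaryLadder} {J K : Bar}
    (h : E.pair? = some (J, K)) : K.Overlaps J := by
  cases E with
  | R J' K' h' =>
    obtain ⟨rfl, rfl⟩ : J' = J ∧ K' = K := by simpa [pair?] using h
    exact h'
  | Iplus _ => simp [pair?] at h
  | Iminus _ => simp [pair?] at h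

theorem map_fst_filterMap_pair?_le (L : Multiset ElementaryLadder) :
    (L.filterMap pair?).map Prod.fst ≤ L.filterMap src? := by
  induction L using Multiset.induction_on with
  | empty => simp
  | cons E L ih =>
    cases E with
    | R J K h => simpa [Multiset.filterMap_cons, pair?, src?] using ih
    | Iplus J =>
      simpa [Multiset.filterMap_cons, pair?, src?] using ih.trans (Multiset.le_cons_self _ J)
    | Iminus K => simpa [Multiset.filterMap_cons, pair?, src?] using ih

theorem map_snd_filterMap_pair?_le (L : Multiset ElementaryLadder) :
    (L.filterMap pair?).map Prod.snd ≤ L.filterMap tgt? := by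
  induction L using Multiset.induction_on with
  | empty => simp
  | cons E L ih =>
    cases E with
    | R J K h => simpa [Multiset.filterMap_cons, pair?, tgt?] using ih
    | Iplus J => simpa [Multiset.filterMap_cons, pair?, tgt?] using ih
    | Iminus K =>
      simpa [Multiset.filterMap_cons, pair?, tgt?] using ih.trans (Multiset.le_cons_self _ K)

/-- The shift of an elementary ladder module. -/
def shift (d : ℤ) : ElementaryLadder → ElementaryLadder
  | R J K h => R (J.shift d) (K.shift d) ⟨Int.sub_le_sub_right h.1 d, Int.sub_le_sub_right h.2.1 d,
      Int.sub_le_sub_right h.2.2 d⟩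
  | Iplus J => Iplus (J.shift d)
  | Iminus K => Iminus (K.shift d)

end ElementaryLadder

theorem Bar.shift_injective (d : ℤ) : Function.Injective (Bar.shift d) := by
  intro J K h
  have h1 : J.fst - d = K.fst - d := congrArg (fun J : Bar => J.fst) h
  have h2 : J.snd - d = K.snd - d := congrArg (fun J : Bar => J.snd) h
  exact NonemptyInterval.ext (Prod.ext (by lia) (by lia))

theorem Bar.shift_shift (d e : ℤ) (J : Bar) : (J.shift d).shift e = J.shift (d + e) :=
  NonemptyInterval.ext (Prod.ext (sub_sub _ _ _) (sub_sub _ _ _))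

theorem Bar.shift_zero (J : Bar) : J.shift 0 = J :=
  NonemptyInterval.ext (Prod.ext (sub_zero _) (sub_zero _))

theorem ElementaryLadder.pair?_shift_eq_some_iff {E : ElementaryLadder} {J K : Bar} {d : ℤ} :
    (E.shift d).pair? = some (J.shift d, K.shift d) ↔ E.pair? = some (J, K) := by
  cases E <;> simp [ElementaryLadder.shift, ElementaryLadder.pair?,
    (Bar.shift_injective d).eq_iff]

/-! ### Uniqueness of decompositions -/

/-- Common form of uniqueness for barcodes and for the source and target bars of ladder
decompositions. -/
theorem IsIntervalBasis.filterMap_eq {ι ι' α α' : Type} [Fintype ι] [Fintype ι']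
    {V : ℤ ⥤ ModuleCat.{u} F} {S : ι → Set ℤ} {S' : ι' → Set ℤ} {x : ι → ∀ t, V.obj t}
    {x' : ι' → ∀ t, V.obj t} (h : IsIntervalBasis V S x) (h' : IsIntervalBasis V S' x')
    (hS : ∀ i, IsBarSupport (S i)) (hS' : ∀ i, IsBarSupport (S' i)) (E : ι → α) (E' : ι' → α')
    {g : α → Option Bar} {g' : α' → Option Bar} (hg : ∀ i J, g (E i) = some J ↔ S i = J.support)
    (hg' : ∀ i J, g' (E' i) = some J ↔ S' i = J.support) :
    (Finset.univ.val.map E).filterMap g = (Finset.univ.val.map E').filterMap g' := by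
  classical
  ext J
  rw [count_filterMap_map_univ, count_filterMap_map_univ]
  simp only [hg, hg']
  exact le_antisymm (h.card_supports_le h' hS' J) (h'.card_supports_le h hS J)

theorem IsBarcode.eq {V : ℤ ⥤ ModuleCat.{u} F} {B B' : Multiset Bar} (h : IsBarcode V B)
    (h' : IsBarcode V B') : B = B' := by
  obtain ⟨ι, _, J, x, rfl, hx⟩ := isBarcode_iff.1 h
  obtain ⟨ι', _, J', x', rfl, hx'⟩ := isBarcode_iff.1 h'
  have := hx.filterMap_eq hx' (fun i => Or.inr ⟨_, rfl⟩) (fun i => Or.inr ⟨_, rfl⟩) J J'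
    (g := some) (g' := some) (fun i K => by simp [Bar.support_injective.eq_iff])
    (fun i K => by simp [Bar.support_injective.eq_iff])
  simpa using this

theorem IsBarcode.shift {V : ℤ ⥤ ModuleCat.{u} F} {B : Multiset Bar} (h : IsBarcode V B) (d : ℤ) :
    IsBarcode (Ladder.shift d V) (B.map (Bar.shift d)) := by
  obtain ⟨ι, _, J, x, rfl, hx⟩ := isBarcode_iff.1 h
  exact isBarcode_iff.2 ⟨ι, _, fun i => (J i).shift d, _, by rw [Multiset.map_map]; rfl,
    (hx.shift d).congr_supports fun i => Bar.support_shift _ _⟩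

theorem IsLadderDecomposition.filterMap_src? {V W : ℤ ⥤ ModuleCat.{u} F} {Φ : V ⟶ W}
    {L : Multiset ElementaryLadder} {B : Multiset Bar} (h : IsLadderDecomposition Φ L)
    (hB : IsBarcode V B) : L.filterMap ElementaryLadder.src? = B := by
  obtain ⟨ι, _, E, x, y, rfl, hxy⟩ := isLadderDecomposition_iff.1 h
  obtain ⟨κ, _, J, z, rfl, hz⟩ := isBarcode_iff.1 hB
  have := hxy.left.filterMap_eq hz (fun i => (E i).isBarSupport_srcSupport)
    (fun i => Or.inr ⟨_, rfl⟩) E J (g := ElementaryLadder.src?) (g' := some)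
    (fun i K => ElementaryLadder.src?_eq_some_iff)
    (fun i K => by simp [Bar.support_injective.eq_iff])
  simpa using this

theorem IsLadderDecomposition.filterMap_tgt? {V W : ℤ ⥤ ModuleCat.{u} F} {Φ : V ⟶ W}
    {L : Multiset ElementaryLadder} {B : Multiset Bar} (h : IsLadderDecomposition Φ L)
    (hB : IsBarcode W B) : L.filterMap ElementaryLadder.tgt? = B := by
  obtain ⟨ι, _, E, x, y, rfl, hxy⟩ := isLadderDecomposition_iff.1 h
  obtain ⟨κ, _, J, z, rfl, hz⟩ := isBarcode_iff.1 hB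
  have := hxy.right.filterMap_eq hz (fun i => (E i).isBarSupport_tgtSupport)
    (fun i => Or.inr ⟨_, rfl⟩) E J (g := ElementaryLadder.tgt?) (g' := some)
    (fun i K => ElementaryLadder.tgt?_eq_some_iff)
    (fun i K => by simp [Bar.support_injective.eq_iff])
  simpa using this

theorem IsLadderDecomposition.filterMap_pair?_eq {V W : ℤ ⥤ ModuleCat.{u} F} {Φ : V ⟶ W}
    {L L' : Multiset ElementaryLadder} (h : IsLadderDecomposition Φ L)
    (h' : IsLadderDecomposition Φ L') :
    L.filterMap ElementaryLadder.pair? = L'.filterMap ElementaryLadder.pair? := by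
  classical
  obtain ⟨ι, _, E, x, y, rfl, hE⟩ := isLadderDecomposition_iff.1 h
  obtain ⟨ι', _, E', x', y', rfl, hE'⟩ := isLadderDecomposition_iff.1 h'
  ext ⟨J, K⟩
  rw [count_filterMap_map_univ, count_filterMap_map_univ]
  by_cases hKJ : K.Overlaps J
  · simp only [ElementaryLadder.pair?_eq_some_iff hKJ]
    exact le_antisymm (hE.card_R_le hE' hKJ) (hE'.card_R_le hE hKJ)
  · have : IsEmpty {i // (E i).pair? = some (J, K)} :=
      ⟨fun i => hKJ (ElementaryLadder.overlaps_of_pair?_eq_some i.2)⟩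
    have : IsEmpty {i // (E' i).pair? = some (J, K)} :=
      ⟨fun i => hKJ (ElementaryLadder.overlaps_of_pair?_eq_some i.2)⟩
    rw [Nat.card_of_isEmpty, Nat.card_of_isEmpty]

theorem lt_of_lt_nestedness {V : ℤ ⥤ ModuleCat.{u} F} {δ : ℕ}
    (h : 2 * (δ : ℕ∞) < nestedness V) {J K : Bar} (hJ : J ∈ barcode V) (hK : K ∈ barcode V)
    (hJK : J.StrictlyNested K) : 2 * (δ : ℤ) < J.fst - K.fst ∧ 2 * (δ : ℤ) < K.snd - J.snd := by
  have h1 : nestedness V ≤ ((min (J.fst - K.fst).natAbs (J.snd - K.snd).natAbs : ℕ) : ℕ∞) :=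
    (iInf₂_le J hJ).trans ((iInf₂_le K hK).trans (iInf_le _ hJK))
  have h2 : 2 * δ < min (J.fst - K.fst).natAbs (J.snd - K.snd).natAbs := by
    exact_mod_cast h.trans_le h1
  obtain ⟨h3, h4⟩ := hJK
  rw [lt_min_iff] at h2
  lia

/-! ### Shifted morphisms -/

/-- The shift of a morphism. -/
noncomputable def shiftMap (d : ℤ) {V W : ℤ ⥤ ModuleCat.{u} F} (Φ : V ⟶ W) :
    shift d V ⟶ shift d W where
  app t := Φ.app (t + d)
  naturality _ _ _ := Φ.naturality _

/-- The isomorphism `V(d)(e) ≅ V(d + e)`. -/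
noncomputable def shiftShiftIso (d e : ℤ) (V : ℤ ⥤ ModuleCat.{u} F) :
    shift e (shift d V) ≅ shift (d + e) V where
  hom :=
    { app := fun t => V.map (homOfLE (by lia : t + e + d ≤ t + (d + e)))
      naturality := fun s t f => by
        change V.map (homOfLE _) ≫ V.map _ = V.map _ ≫ V.map (homOfLE _)
        rw [← V.map_comp, ← V.map_comp]
        rfl }
  inv :=
    { app := fun t => V.map (homOfLE (by lia : t + (d + e) ≤ t + e + d))
      naturality := fun s t f => by
        change V.map (homOfLE _) ≫ V.map _ = V.map _ ≫ V.map (homOfLE _)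
        rw [← V.map_comp, ← V.map_comp]
        rfl }
  hom_inv_id := NatTrans.ext (funext fun t => (V.map_comp _ _).symm.trans (V.map_id _))
  inv_hom_id := NatTrans.ext (funext fun t => (V.map_comp _ _).symm.trans (V.map_id _))

namespace IsLadderBasis

variable {ι : Type} [Fintype ι] {V W : ℤ ⥤ ModuleCat.{u} F}
    {Φ : V ⟶ W} {E : ι → ElementaryLadder} {x : ι → ∀ t, V.obj t} {y : ι → ∀ t, W.obj t}

theorem shift (h : IsLadderBasis Φ E x y) (d : ℤ) :
    IsLadderBasis (shiftMap d Φ) (fun i => (E i).shift d) (fun i t => x i (t + d))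
      fun i t => y i (t + d) := by
  have hs (i : ι) : {t | t + d ∈ (E i).srcSupport} = ((E i).shift d).srcSupport := by
    cases E i with
    | R J K _ => exact Bar.support_shift J d
    | Iplus J => exact Bar.support_shift J d
    | Iminus K => rfl
  have ht (i : ι) : {t | t + d ∈ (E i).tgtSupport} = ((E i).shift d).tgtSupport := by
    cases E i with
    | R J K _ => exact Bar.support_shift K d
    | Iplus J => rfl
    | Iminus K => exact Bar.support_shift K d
  exact ⟨(h.left.shift d).congr_supports hs, (h.right.shift d).congr_supports ht,
    fun i t hi => h.app_eq i (t + d) ((hs i).ge hi)⟩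

theorem comp_iso (h : IsLadderBasis Φ E x y) {W' : ℤ ⥤ ModuleCat.{u} F} (e : W ≅ W') :
    IsLadderBasis (Φ ≫ e.hom) E x fun i t => (e.hom.app t).hom (y i t) :=
  ⟨h.left, h.right.map_iso e, fun i t hi => congrArg (e.hom.app t).hom (h.app_eq i t hi)⟩

end IsLadderBasis

/-! ### Interleavings: decompositions and induced matchings -/

section Main

variable {V W : ℤ ⥤ ModuleCat.{u} F} {δ : ℕ} {Φ : V ⟶ shift δ W} {Ψ : W ⟶ shift δ V}

theorem IsInterleaving.symm (h : IsInterleaving δ Φ Ψ) : IsInterleaving δ Ψ Φ :=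
  ⟨h.right, h.left⟩

theorem IsInterleaving.app_app_left (h : IsInterleaving δ Φ Ψ) (t : ℤ) (v : V.obj t) :
    ((shiftMap δ Ψ ≫ (shiftShiftIso δ δ V).hom).app t).hom ((Φ.app t).hom v) =
      (V.map (homOfLE (by lia : t ≤ t + ((δ : ℤ) + δ)))).hom v := by
  have h1 := LinearMap.congr_fun (h.left t) v
  change (V.map (homOfLE (by lia : t + δ + δ ≤ t + ((δ : ℤ) + δ)))).hom
    ((Ψ.app (t + δ)).hom ((Φ.app t).hom v)) = _
  exact (congrArg _ h1).trans (map_map_apply V _ _ v)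

theorem IsInterleaving.app_app_right (h : IsInterleaving δ Φ Ψ) (t : ℤ) (w : (shift δ W).obj t) :
    (Φ.app (t + ((δ : ℤ) + δ))).hom
      (((shiftMap δ Ψ ≫ (shiftShiftIso δ δ V).hom).app t).hom w) =
      ((shift δ W).map (homOfLE (by lia : t ≤ t + ((δ : ℤ) + δ)))).hom w := by
  have h1 := LinearMap.congr_fun (h.right (t + δ)) w
  have h2 := naturality_apply Φ (by lia : t + δ + δ ≤ t + ((δ : ℤ) + δ)) ((Ψ.app (t + δ)).hom w)
  exact h2.trans ((congrArg _ h1).trans (map_map_apply W _ _ w))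

theorem IsInterleaving.exists_isLadderDecomposition (h : IsInterleaving δ Φ Ψ)
    (hV : IsPersistenceModule V) (hW : IsPersistenceModule W)
    (hδ : 2 * (δ : ℕ∞) < min (nestedness V) (nestedness W)) :
    ∃ L, IsLadderDecomposition Φ L := by
  obtain ⟨hδV, hδW⟩ := lt_min_iff.1 hδ
  obtain ⟨ι, _, J, x, hJ, hx⟩ := isBarcode_iff.1 hV.isBarcode_barcode
  obtain ⟨κ, _, K, y, hK, hy⟩ := isBarcode_iff.1 hW.isBarcode_barcode
  have hJm (j : ι) : J j ∈ barcode V := hJ ▸ Multiset.mem_map_of_mem _ (Finset.mem_univ_val j)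
  have hKm (k : κ) : K k ∈ barcode W := hK ▸ Multiset.mem_map_of_mem _ (Finset.mem_univ_val k)
  refine Ladder.exists_isLadderDecomposition hx
    (K := fun k => (K k).shift δ) ((hy.shift δ).congr_supports fun k => Bar.support_shift _ _)
    (d := (δ : ℤ) + δ) (by lia) Φ _ h.app_app_left (fun j j' hn => ?_) (fun k k' hn => ?_)
  · have := lt_of_lt_nestedness hδV (hJm j) (hJm j') hn
    lia
  · have hn' : (K k).StrictlyNested (K k') := by
      obtain ⟨h1, h2⟩ := hn
      simp only [Bar.shift] at h1 h2
      exact ⟨by lia, by lia⟩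
    have := lt_of_lt_nestedness hδW (hKm k) (hKm k') hn'
    simp only [Bar.shift]
    lia

theorem IsInterleaving.count_le (h : IsInterleaving δ Φ Ψ) (hV : IsPersistenceModule V)
    (hδ : 2 * (δ : ℕ∞) < nestedness V) {L L' : Multiset ElementaryLadder}
    (hL : IsLadderDecomposition Φ L) (hL' : IsLadderDecomposition Ψ L') {J K : Bar}
    (hJ : 2 * (δ : ℤ) ≤ J.length) (hK : 2 * (δ : ℤ) ≤ K.length) [DecidableEq (Bar × Bar)] :
    (L.filterMap ElementaryLadder.pair?).count (J, K.shift δ) ≤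
      (L'.filterMap ElementaryLadder.pair?).count (K, J.shift δ) := by
  have hsrc := hL.filterMap_src? hV.isBarcode_barcode
  obtain ⟨ι, _, E, x, y, rfl, hE⟩ := isLadderDecomposition_iff.1 hL
  obtain ⟨ι', _, E', y', x', rfl, hE'⟩ := isLadderDecomposition_iff.1 hL'
  rw [count_filterMap_map_univ, count_filterMap_map_univ]
  -- An actual summand is needed to obtain the overlap relations without which the two `R` terms
  -- cannot be written.
  rcases isEmpty_or_nonempty {i // (E i).pair? = some (J, K.shift δ)} with hem | ⟨⟨m, hm⟩⟩
  · rw [Nat.card_of_isEmpty]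
    exact Nat.zero_le _
  have hKJ := ElementaryLadder.overlaps_of_pair?_eq_some hm
  rw [ElementaryLadder.pair?_eq_some_iff hKJ] at hm
  simp only [NonemptyInterval.length] at hJ hK
  have hJ' : J.fst + ((δ : ℤ) + δ) ≤ J.snd := by lia
  have hK' : (K.shift δ).fst + ((δ : ℤ) + δ) ≤ (K.shift δ).snd := by
    simp only [Bar.shift]
    lia
  have hd : 0 ≤ (δ : ℤ) + δ := by lia
  have hJK := hE.overlaps_shift hd h.app_app_left hJ' hm
  have hsm (i : ι) (J : Bar) (hi : (E i).srcSupport = J.support) : J ∈ barcode V := by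
    rw [← hsrc, Multiset.mem_filterMap]
    exact ⟨E i, Multiset.mem_map_of_mem _ (Finset.mem_univ_val i),
      ElementaryLadder.src?_eq_some_iff.2 hi⟩
  have key := hE.card_R_le_of_interleaving (hKJ := hKJ)
    ((hE'.shift δ).comp_iso (shiftShiftIso δ δ V)) hd h.app_app_left h.app_app_right
    (fun i i' J J' hi hi' hn => by
      have := lt_of_lt_nestedness hδ (hsm i J hi) (hsm i' J' hi') hn
      lia) hJ' hK' hJK
  -- The bound concerns pairs (K(δ), J(2δ)) of the shifted Ψ; cancelling one shift gives the pairs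
  -- (K, J(δ)) of Ψ.
  simp only [← ElementaryLadder.pair?_eq_some_iff] at key
  simpa only [← Bar.shift_shift, ElementaryLadder.pair?_shift_eq_some_iff] using key

theorem existsUnique_isInducedMatching (hV : IsPersistenceModule V) (hW : IsPersistenceModule W)
    {L : Multiset ElementaryLadder} (hL : IsLadderDecomposition Φ L) :
    ∃! χ : PartialMatching (barcode V) (barcode W), IsInducedMatching δ Φ χ := by
  have hinj : Function.Injective fun p : Bar × Bar => (p.1, p.2.shift δ) := fun p q hpq =>
    Prod.ext (Prod.ext_iff.1 hpq).1 (Bar.shift_injective _ (Prod.ext_iff.1 hpq).2)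
  have hcancel (K : Bar) : (K.shift (-δ)).shift δ = K := by
    rw [Bar.shift_shift, neg_add_cancel, Bar.shift_zero]
  have hcancel' (K : Bar) : (K.shift δ).shift (-δ) = K := by
    rw [Bar.shift_shift, add_neg_cancel, Bar.shift_zero]
  refine ⟨⟨(L.filterMap ElementaryLadder.pair?).map fun p => (p.1, p.2.shift (-δ)), ?_, ?_⟩,
    ⟨L, hL, ?_⟩, ?_⟩
  · rw [Multiset.map_map, ← hL.filterMap_src? hV.isBarcode_barcode]
    exact ElementaryLadder.map_fst_filterMap_pair?_le L
  · have h1 := Multiset.map_le_map (f := Bar.shift (-δ))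
      (ElementaryLadder.map_snd_filterMap_pair?_le L)
    rw [hL.filterMap_tgt? (hW.isBarcode_barcode.shift δ), Multiset.map_map, Multiset.map_map] at h1
    simpa [Function.comp_def, hcancel'] using h1
  · simp [Multiset.map_map, hcancel]
  · rintro χ ⟨L', hL', hχ⟩
    refine PartialMatching.ext (Multiset.map_injective hinj ?_)
    rw [← hχ, hL'.filterMap_pair?_eq hL]
    simp [Multiset.map_map, hcancel]

theorem count_pairs_eq {χ : PartialMatching (barcode V) (barcode W)}
    {L : Multiset ElementaryLadder}
    (hχ : L.filterMap ElementaryLadder.pair? = χ.pairs.map fun p => (p.1, p.2.shift δ))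
    (J K : Bar) [DecidableEq (Bar × Bar)] :
    χ.pairs.count (J, K) = (L.filterMap ElementaryLadder.pair?).count (J, K.shift δ) := by
  have hinj : Function.Injective fun p : Bar × Bar => (p.1, p.2.shift δ) := fun p q hpq =>
    Prod.ext (Prod.ext_iff.1 hpq).1 (Bar.shift_injective _ (Prod.ext_iff.1 hpq).2)
  rw [hχ]
  exact (Multiset.count_map_eq_count' _ _ hinj (J, K)).symm

end Main

end Ladder

theorem mainTheorem5 {F : Type u} [Field F] (V W : ℤ ⥤ ModuleCat.{u} F)
    (hV : Ladder.IsPersistenceModule V) (hW : Ladder.IsPersistenceModule W)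
    (δ : ℕ) (Φ : V ⟶ Ladder.shift δ W) (Ψ : W ⟶ Ladder.shift δ V)
    (hΦΨ : Ladder.IsInterleaving δ Φ Ψ)
    (hδ : 2 * (δ : ℕ∞) < min (Ladder.nestedness V) (Ladder.nestedness W)) :
    (∃! χΦ : Ladder.PartialMatching (Ladder.barcode V) (Ladder.barcode W),
      Ladder.IsInducedMatching δ Φ χΦ) ∧
    (∃! χΨ : Ladder.PartialMatching (Ladder.barcode W) (Ladder.barcode V),
      Ladder.IsInducedMatching δ Ψ χΨ) ∧
    ∀ (χΦ : Ladder.PartialMatching (Ladder.barcode V) (Ladder.barcode W))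
      (χΨ : Ladder.PartialMatching (Ladder.barcode W) (Ladder.barcode V)),
      Ladder.IsInducedMatching δ Φ χΦ → Ladder.IsInducedMatching δ Ψ χΨ →
      ∀ JV ∈ Ladder.barcode V, ∀ JW ∈ Ladder.barcode W,
        2 * (δ : ℤ) ≤ JV.length → 2 * (δ : ℤ) ≤ JW.length →
        ∀ μ : ℕ, ((JV, JW), μ) ∈ Ladder.withMult χΦ.pairs ↔
          ((JW, JV), μ) ∈ Ladder.withMult χΨ.pairs := by
  obtain ⟨LΦ, hLΦ⟩ := hΦΨ.exists_isLadderDecomposition hV hW hδ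
  obtain ⟨LΨ, hLΨ⟩ := hΦΨ.symm.exists_isLadderDecomposition hW hV (by rwa [min_comm])
  obtain ⟨hδV, hδW⟩ := lt_min_iff.1 hδ
  refine ⟨Ladder.existsUnique_isInducedMatching hV hW hLΦ,
    Ladder.existsUnique_isInducedMatching hW hV hLΨ, ?_⟩
  rintro χΦ χΨ ⟨L, hL, hχΦ⟩ ⟨L', hL', hχΨ⟩ JV - JW - hJV hJW μ
  have h : χΦ.pairs.count (JV, JW) = χΨ.pairs.count (JW, JV) := by
    rw [Ladder.count_pairs_eq hχΦ, Ladder.count_pairs_eq hχΨ]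
    exact le_antisymm (hΦΨ.count_le hV hδV hL hL' hJV hJW)
      (hΦΨ.symm.count_le hW hδW hL' hL hJW hJV)
  simp only [Ladder.withMult, Set.mem_ofPred_eq, h]
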